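/- **Theorem (average minimum transmit power for angle-based user selection, two users).** Let $M,K\ge 2$ with $(M-1)(K-1)>1$ (for $M\ge2$ this holds for every $K>2$), and let $\sigma>0$. A base station with $M$ antennas serves single-antenna users with channel vectors $\mathbf h_1,\dots,\mathbf h_K\in\mathbb C^M$ whose entries are i.i.d. circularly symmetric complex Gaussian with zero mean and unit variance; the receiver noise variance is $\sigma^2$. Two users are selected by angle-based selection (AUS): the first, with channel $\mathbf f$, has the largest channel norm; the second, with channel $\mathbf s$, is, among the other $K-1$ users, the one most orthogonal to the first, i.e. the one that maximizes $\sin^2\theta(\mathbf h_k,\mathbf f)=1-|\mathbf f^\dagger\mathbf h_k|^2/(\|\mathbf f\|^2\|\mathbf h_k\|^2)$. For an SINR target $\gamma>0$ let $p_{\min}(\gamma)$ be the minimum instantaneous transmit power $p_1+p_2$ over both encoding orders $(\mathbf g_1,\mathbf g_2)\in\{(\mathbf s,\mathbf f),(\mathbf f,\mathbf s)\}$, powers $p_1,p_2>0$ and unit-norm beamforming vectors $\mathbf v_1,\mathbf v_2\in\mathbb C^M$ that satisfy, with dirty-paper encoding, $$\frac{p_1|\mathbf g_1^\dagger\mathbf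 v_1|^2}{\sigma^2}\ge\gamma,\qquad \frac{p_2|\mathbf g_2^\dagger\mathbf v_2|^2}{p_1|\mathbf g_2^\dagger\mathbf v_1|^2+\sigma^2}\ge\gamma .$$ Let $p_{\mathrm{tx}}(\gamma)=\sigma^2\left(\frac{\gamma}{\|\mathbf s\|^2}+\frac{\gamma}{\|\mathbf f\|^2\sin^2\theta(\mathbf f,\mathbf s)}\right)$ be the high-SINR expression of the minimum instantaneous transmit power. Put $$C_{M,K}=\frac{1}{K-1}\left(\frac{K}{M-1}-\alpha_{M,K}\right)+\frac{(M-1)(K-1)\,\alpha_{M,K}}{(M-1)(K-1)-1},$$ $$\alpha_{M,K}=\int_0^\infty K\,\frac{e^{-x}x^{M-2}}{\Gamma(M)}\,[G(M,x)]^{K-1}\,dx,\qquad G(M,x)=\frac1{\Gamma(M)}\int_0^x e^{-t}t^{M-1}\,dt .$$ Then: 1. for every $\gamma>0$, $p_{\mathrm{tx}}(\gamma)$ is integrable and the high-SINR average minimum transmit power is $\mathbb E[p_{\mathrm{tx}}(\gamma)]=\gamma\sigma^2C_{M,K}$; 2. for every $\gamma>0$, almost surely the minimum defining $p_{\min}(\gamma)$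 is attained, and $p_{\min}(\gamma)$ is integrable; moreover, as $\gamma\to\infty$, the exact average minimum transmit power satisfies $\mathbb E[p_{\min}(\gamma)]\sim\gamma\sigma^2C_{M,K}$ (the ratio of the two sides tends to $1$). -/

import Mathlib

open MeasureTheory ProbabilityTheory

noncomputable section

/-- Circularly symmetric complex Gaussian law with zero mean and unit variance: independent real
and imaginary parts, each centred real Gaussian of variance `1/2`. -/
def stdComplexGaussian : Measure ℂ :=
  ((gaussianReal 0 (1 / 2)).prod (gaussianReal 0 (1 / 2))).map
    (fun z : ℝ × ℝ => (⟨z.1, z.2⟩ : ℂ))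

/-- The channel vectors `h k`, `k < K`, in `ℂ^M` have i.i.d. zero-mean unit-variance complex
Gaussian entries. -/
structure IsGaussianChannel {Ω : Type*} [MeasurableSpace Ω] (P : Measure Ω) {M K : ℕ}
    (h : Fin K → Ω → EuclideanSpace ℂ (Fin M)) : Prop where
  indep : iIndepFun (fun (e : Fin K × Fin M) (ω : Ω) => h e.1 ω e.2) P
  law : ∀ k m, HasLaw (fun ω => h k ω m) stdComplexGaussian P

/-- `sin² θ`, where `θ` is the angle between the vector `x` and the subspace `W`:
`cos² θ` is the fraction of the energy of `x` that lies in `W`. -/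
def sinSqAngle {M : ℕ} (x : EuclideanSpace ℂ (Fin M))
    (W : Submodule ℂ (EuclideanSpace ℂ (Fin M))) : ℝ :=
  1 - ‖W.starProjection x‖ ^ 2 / ‖x‖ ^ 2

/-- Angle-based selection of two users: `first` has the largest channel norm, and `second` is,
among all the other users, one that is most orthogonal to `first`. -/
structure IsAngleBasedSelection {M K : ℕ} (h : Fin K → EuclideanSpace ℂ (Fin M))
    (first second : Fin K) : Prop where
  strongest : ∀ k, ‖h k‖ ≤ ‖h first‖
  ne : second ≠ first
  most_orthogonal : ∀ k, k ≠ first →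
    sinSqAngle (h k) (Submodule.span ℂ {h first}) ≤
      sinSqAngle (h second) (Submodule.span ℂ {h first})

/-- Downlink SINR of user `k` with dirty-paper encoding in the order `n - 1, …, 1, 0`: user `k`
is disturbed only by the streams of the users `j < k`, which are encoded after it.  Here `h` are
the channels, `p` the powers, `v` the beamforming vectors, `σ ^ 2` the noise variance; the inner
product is conjugate-linear in its first argument, so `inner ℂ (h k) (v j)` is `h_k† v_j`. -/
def downlinkSINR {M n : ℕ} (σ : ℝ) (h : Fin n → EuclideanSpace ℂ (Fin M)) (p : Fin n → ℝ)
    (v : Fin n → EuclideanSpace ℂ (Fin M)) (k : Fin n) : ℝ :=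
  p k * ‖inner ℂ (h k) (v k)‖ ^ 2 /
    (∑ j ∈ Finset.Iio k, p j * ‖inner ℂ (h k) (v j)‖ ^ 2 + σ ^ 2)

/-- Total transmit powers with which all users with channels `h` can be given an SINR of at least
`γ`, by some encoding order `π`, power allocation `p` and unit-norm beamforming vectors `v`. -/
def achievablePowers {M n : ℕ} (σ γ : ℝ) (h : Fin n → EuclideanSpace ℂ (Fin M)) : Set ℝ :=
  {t | ∃ (π : Equiv.Perm (Fin n)) (p : Fin n → ℝ) (v : Fin n → EuclideanSpace ℂ (Fin M)),
    (∀ k, 0 < p k) ∧ (∀ k, ‖v k‖ = 1) ∧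
    (∀ k, γ ≤ downlinkSINR σ (fun i => h (π i)) p v k) ∧ t = ∑ k, p k}

/-- The minimum instantaneous transmit power that meets the SINR target `γ` at all users. -/
def minTransmitPower {M n : ℕ} (σ γ : ℝ) (h : Fin n → EuclideanSpace ℂ (Fin M)) : ℝ :=
  sInf (achievablePowers σ γ h)

/-- The high-SINR expression `σ² ∑ i, γ / (‖h i‖² sin² θ_i)` of the minimum instantaneous transmit
power, where `θ_i` is the angle of `h i` with the span of the `h j`, `j < i` (so `sin² θ_0 = 1`). -/
def highSINRPower {M n : ℕ} (σ γ : ℝ) (h : Fin n → EuclideanSpace ℂ (Fin M)) : ℝ :=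
  σ ^ 2 * ∑ i, γ / (‖h i‖ ^ 2 * sinSqAngle (h i) (Submodule.span ℂ (h '' Set.Iio i)))

/-- Regularized (lower incomplete) Gamma function `G(M, x)`. -/
def regGamma (M : ℕ) (x : ℝ) : ℝ :=
  1 / Real.Gamma M * ∫ t in (0 : ℝ)..x, Real.exp (-t) * t ^ (M - 1)

/-- The constant `α_{M,K}` (used for `M ≥ 2`, `K ≥ 1`). -/
def alphaConst (M K : ℕ) : ℝ :=
  ∫ x in Set.Ioi (0 : ℝ),
    (K : ℝ) * (Real.exp (-x) * x ^ (M - 2) / Real.Gamma M) * regGamma M x ^ (K - 1)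

end

/-!
Write `f` for the channel of the first selected user, `s` for that of the second, and `S` for the
`sin²` of the angle between them.

*One realization.* If `g₂` is encoded before `g₁`, the best beam for `g₂` points along `g₂`, and the
power spent on `g₁` is governed by a Cauchy–Schwarz inequality for the inner product
`⟪v, w⟫ + γ ⟪v, u⟫⟪u, w⟫`, `u = g₂ / ‖g₂‖` (`one_add_mul_norm_inner_sq_le`), whose equality case
gives the optimal beam. The minimum is `orderedPower σ γ g₁ g₂`. It is best to encode the weaker
user first, so the minimum over both orders is
`γ σ² (1 / ‖s‖² + (1 + γ) / (‖f‖² (1 + γ S)))` (`isLeast_achievablePowers`). As `γ → ∞` the bracket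
tends to `1 / ‖s‖² + 1 / (‖f‖² S)`, which also dominates it, so that the asymptotic statement
follows from dominated convergence once that limit is known to be integrable.

*Independence of norms and angles.* The law of a channel vector in `ℂ^M` has the characteristic
function `exp (-‖t‖² / 4)`, hence is invariant under unitary maps. Relative to a fixed direction it
therefore looks like a vector split into its first coordinate and the rest, with energies
`a ∼ Exp(1)` and `b ∼ Gamma(M - 1)`; then `a + b ∼ Gamma(M)` and `b / (a + b) ∼ Beta(M - 1, 1)` are
independent (`lintegral_gammaLaw_prod_gammaLaw`). Consequently, given the channel of user `i`, the
norms of all the others and their angles with it are all independent.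

*Selection.* For an ordered pair of users, `selectionEvent` is the event that the pair is selected
without ties. Expectations over it factorize into an integral over the norms and one over the
angles (`setLIntegral_selectionEvent`). The probabilities of these disjoint events add up to `1`,
so ties need no separate treatment, and the sums of the expectations of `1 / ‖s‖²` and
`1 / (‖f‖² S)` over all the pairs are the two terms of the constant in the theorem. These
expectations are computed as Lebesgue integrals with values in `[0, ∞]`, where `0⁻¹ = ∞`; that they
are finite shows that almost surely `s ≠ 0` and `S > 0`.

In the lemmas, `M = m + 2` is the number of antennas and `K = n + 2` that of users.
-/

/-! ### Minimum transmit power of two users -/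

section Optimization

variable {M : ℕ}

/-- The minimum transmit power for two users when the user with channel `g₂` is encoded first, so
that its reception suffers from the beam sent to the user with channel `g₁`. -/
noncomputable def orderedPower (σ γ : ℝ) (g₁ g₂ : EuclideanSpace ℂ (Fin M)) : ℝ :=
  γ * σ ^ 2 * (1 / ‖g₂‖ ^ 2 +
    (1 + γ) / (‖g₁‖ ^ 2 * (1 + γ * sinSqAngle g₁ (Submodule.span ℂ {g₂}))))

lemma sinSqAngle_span_singleton (x y : EuclideanSpace ℂ (Fin M)) :
    sinSqAngle x (Submodule.span ℂ {y}) = 1 - ‖inner ℂ y x‖ ^ 2 / (‖y‖ ^ 2 * ‖x‖ ^ 2) := by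
  unfold sinSqAngle
  rw [Submodule.starProjection_singleton, norm_smul]
  rcases eq_or_ne y 0 with rfl | hy
  · simp
  · have : ‖y‖ ≠ 0 := norm_ne_zero_iff.2 hy
    have e : ‖inner ℂ y x / ((‖y‖ ^ 2 : ℝ) : ℂ)‖ = ‖inner ℂ y x‖ / ‖y‖ ^ 2 := by
      rw [norm_div, Complex.norm_real, norm_pow, norm_norm]
    erw [e]
    rw [div_mul_eq_mul_div, div_pow, div_div, mul_pow]
    congr 1
    rcases eq_or_ne x 0 with rfl | hx
    · simp
    · have : ‖x‖ ≠ 0 := norm_ne_zero_iff.2 hx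
      field_simp

lemma sinSqAngle_span_singleton_comm (x y : EuclideanSpace ℂ (Fin M)) :
    sinSqAngle x (Submodule.span ℂ {y}) = sinSqAngle y (Submodule.span ℂ {x}) := by
  rw [sinSqAngle_span_singleton, sinSqAngle_span_singleton, norm_inner_symm, mul_comm]

lemma sinSqAngle_span_singleton_nonneg (x y : EuclideanSpace ℂ (Fin M)) :
    0 ≤ sinSqAngle x (Submodule.span ℂ {y}) := by
  rw [sinSqAngle_span_singleton, sub_nonneg, ← mul_pow]
  refine div_le_one_of_le₀ ?_ (by positivity)
  gcongr
  exact norm_inner_le_norm y x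

lemma sinSqAngle_le_one (x : EuclideanSpace ℂ (Fin M))
    (W : Submodule ℂ (EuclideanSpace ℂ (Fin M))) : sinSqAngle x W ≤ 1 := by
  unfold sinSqAngle
  have : 0 ≤ ‖W.starProjection x‖ ^ 2 / ‖x‖ ^ 2 := by positivity
  linarith

/-- Cauchy–Schwarz inequality for the inner product `⟪v, w⟫ + γ ⟪v, u⟫⟪u, w⟫` attached to a unit
vector `u`, in which interference at the receiver `u` is penalized with weight `γ`. -/
lemma one_add_mul_norm_inner_sq_le {γ : ℝ} (hγ : 0 < γ) {u : EuclideanSpace ℂ (Fin M)}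
    (hu : ‖u‖ = 1) (g v : EuclideanSpace ℂ (Fin M)) :
    (1 + γ) * ‖inner ℂ g v‖ ^ 2 ≤
      ((1 + γ) * ‖g‖ ^ 2 - γ * ‖inner ℂ u g‖ ^ 2) * (‖v‖ ^ 2 + γ * ‖inner ℂ u v‖ ^ 2) := by
  have huu : inner ℂ u u = (1 : ℂ) := by simp [inner_self_eq_norm_sq_to_K, hu]
  have orth : ∀ x : EuclideanSpace ℂ (Fin M), inner ℂ u (x - inner ℂ u x • u) = 0 := by
    intro x
    rw [inner_sub_right, inner_smul_right, huu, mul_one, sub_self]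
  have pyth : ∀ x : EuclideanSpace ℂ (Fin M),
      ‖x‖ ^ 2 = ‖inner ℂ u x‖ ^ 2 + ‖x - inner ℂ u x • u‖ ^ 2 := by
    intro x
    have h0 : inner ℂ (inner ℂ u x • u) (x - inner ℂ u x • u) = 0 := by
      rw [inner_smul_left, orth, mul_zero]
    have := norm_add_sq_eq_norm_sq_add_norm_sq_of_inner_eq_zero _ _ h0
    rw [add_sub_cancel, norm_smul, hu, mul_one] at this
    nlinarith [this]
  set d := g - inner ℂ u g • u with hd
  set q := v - inner ℂ u v • u with hq
  -- only the components along `u` and orthogonal to it matter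
  have hsplit : inner ℂ g v = inner ℂ g u * inner ℂ u v + inner ℂ d q := by
    have : inner ℂ d q = inner ℂ g q := by
      rw [hd, inner_sub_left, inner_smul_left, orth, mul_zero, sub_zero]
    rw [this, hq, inner_sub_right, inner_smul_right]
    ring
  have hle : ‖inner ℂ g v‖ ≤ ‖inner ℂ u g‖ * ‖inner ℂ u v‖ + ‖d‖ * ‖q‖ := by
    rw [hsplit]
    refine (norm_add_le _ _).trans ?_
    rw [norm_mul, norm_inner_symm g u]
    gcongr
    exact norm_inner_le_norm d q
  have hsq : ‖inner ℂ g v‖ ^ 2 ≤ (‖inner ℂ u g‖ * ‖inner ℂ u v‖ + ‖d‖ * ‖q‖) ^ 2 := by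
    gcongr
  rw [pyth g, pyth v]
  -- two-dimensional Cauchy–Schwarz with weights `1 + γ` and `1`
  nlinarith [sq_nonneg (‖inner ℂ u g‖ * ‖q‖ - (1 + γ) * ‖d‖ * ‖inner ℂ u v‖),
    mul_le_mul_of_nonneg_left hsq (by linarith : 0 ≤ 1 + γ)]

lemma inner_normalize {x y : EuclideanSpace ℂ (Fin M)} :
    inner ℂ (((‖x‖⁻¹ : ℝ) : ℂ) • x) y = ((‖x‖⁻¹ : ℝ) : ℂ) * inner ℂ x y := by
  rw [inner_smul_left, Complex.conj_ofReal]

lemma norm_normalize {x : EuclideanSpace ℂ (Fin M)} (hx : x ≠ 0) :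
    ‖((‖x‖⁻¹ : ℝ) : ℂ) • x‖ = 1 := by
  rw [norm_smul, Complex.norm_real, norm_inv, norm_norm,
    inv_mul_cancel₀ (norm_ne_zero_iff.2 hx)]

/-- `‖g₁‖² (1 + γ sin² θ)` in terms of the unit vector in the direction of `g₂`. -/
lemma norm_sq_mul_one_add_sinSqAngle (γ : ℝ) {g₁ : EuclideanSpace ℂ (Fin M)} (h₁ : g₁ ≠ 0)
    (g₂ : EuclideanSpace ℂ (Fin M)) :
    ‖g₁‖ ^ 2 * (1 + γ * sinSqAngle g₁ (Submodule.span ℂ {g₂})) =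
      (1 + γ) * ‖g₁‖ ^ 2 - γ * ‖inner ℂ (((‖g₂‖⁻¹ : ℝ) : ℂ) • g₂) g₁‖ ^ 2 := by
  have h₁' : ‖g₁‖ ≠ 0 := norm_ne_zero_iff.2 h₁
  rw [sinSqAngle_span_singleton, inner_normalize, norm_mul, Complex.norm_real, norm_inv,
    norm_norm]
  field_simp
  ring

lemma norm_sq_mul_one_add_sinSqAngle_pos {γ : ℝ} (hγ : 0 < γ) {g₁ : EuclideanSpace ℂ (Fin M)}
    (h₁ : g₁ ≠ 0) (g₂ : EuclideanSpace ℂ (Fin M)) :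
    0 < ‖g₁‖ ^ 2 * (1 + γ * sinSqAngle g₁ (Submodule.span ℂ {g₂})) := by
  have := sinSqAngle_span_singleton_nonneg g₁ g₂
  have h₁' : 0 < ‖g₁‖ := norm_pos_iff.2 h₁
  positivity

lemma norm_inner_sq_eq_normalize {g₂ : EuclideanSpace ℂ (Fin M)} (h₂ : g₂ ≠ 0)
    (v : EuclideanSpace ℂ (Fin M)) :
    ‖inner ℂ g₂ v‖ ^ 2 = ‖g₂‖ ^ 2 * ‖inner ℂ (((‖g₂‖⁻¹ : ℝ) : ℂ) • g₂) v‖ ^ 2 := by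
  have h₂' : ‖g₂‖ ≠ 0 := norm_ne_zero_iff.2 h₂
  rw [inner_normalize, norm_mul, Complex.norm_real, norm_inv, norm_norm]
  field_simp

/-- No powers and beams that meet the target in the given encoding order use less than
`orderedPower`. -/
lemma orderedPower_le {σ γ : ℝ} (hγ : 0 < γ) {g₁ g₂ : EuclideanSpace ℂ (Fin M)}
    (h₁ : g₁ ≠ 0) (h₂ : g₂ ≠ 0) {p₁ p₂ : ℝ} (hp₁ : 0 < p₁) (hp₂ : 0 < p₂)
    {v₁ v₂ : EuclideanSpace ℂ (Fin M)} (hv₁ : ‖v₁‖ = 1) (hv₂ : ‖v₂‖ = 1)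
    (hs₁ : γ * σ ^ 2 ≤ p₁ * ‖inner ℂ g₁ v₁‖ ^ 2)
    (hs₂ : γ * (p₁ * ‖inner ℂ g₂ v₁‖ ^ 2 + σ ^ 2) ≤ p₂ * ‖inner ℂ g₂ v₂‖ ^ 2) :
    orderedPower σ γ g₁ g₂ ≤ p₁ + p₂ := by
  unfold orderedPower
  have hu := norm_normalize h₂
  have hT := norm_sq_mul_one_add_sinSqAngle_pos hγ h₁ g₂
  rw [norm_sq_mul_one_add_sinSqAngle γ h₁ g₂] at hT ⊢
  rw [norm_inner_sq_eq_normalize h₂ v₁] at hs₂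
  set u := ((‖g₂‖⁻¹ : ℝ) : ℂ) • g₂
  set T := (1 + γ) * ‖g₁‖ ^ 2 - γ * ‖inner ℂ u g₁‖ ^ 2
  have hcs := one_add_mul_norm_inner_sq_le hγ hu g₁ v₁
  rw [hv₁] at hcs
  have hn : 0 < ‖g₂‖ := norm_pos_iff.2 h₂
  have hgv : ‖inner ℂ g₂ v₂‖ ^ 2 ≤ ‖g₂‖ ^ 2 := by
    gcongr
    simpa [hv₂] using norm_inner_le_norm (𝕜 := ℂ) g₂ v₂
  set b := ‖inner ℂ u v₁‖ ^ 2
  have e₁ : γ * σ ^ 2 * ((1 + γ) / T) ≤ p₁ * (1 + γ * b) := by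
    rw [← mul_div_assoc, div_le_iff₀ hT]
    nlinarith [mul_le_mul_of_nonneg_left hs₁ (by linarith : 0 ≤ 1 + γ),
      mul_le_mul_of_nonneg_left hcs hp₁.le]
  have e₂ : γ * p₁ * b + γ * σ ^ 2 * (1 / ‖g₂‖ ^ 2) ≤ p₂ := by
    have : (γ * p₁ * b + γ * σ ^ 2 * (1 / ‖g₂‖ ^ 2)) * ‖g₂‖ ^ 2 ≤ p₂ * ‖g₂‖ ^ 2 := by
      calc _ = γ * (p₁ * (‖g₂‖ ^ 2 * b) + σ ^ 2) := by field_simp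
        _ ≤ _ := hs₂
        _ ≤ _ := by gcongr
    exact le_of_mul_le_mul_right this (by positivity)
  linarith

/-- Powers and beams that meet the target in the given encoding order with total power
`orderedPower`. -/
lemma exists_power_beam_eq_orderedPower {σ γ : ℝ} (hσ : 0 < σ) (hγ : 0 < γ)
    {g₁ g₂ : EuclideanSpace ℂ (Fin M)} (h₁ : g₁ ≠ 0) (h₂ : g₂ ≠ 0) :
    ∃ p₁ p₂ : ℝ, ∃ v₁ v₂ : EuclideanSpace ℂ (Fin M), 0 < p₁ ∧ 0 < p₂ ∧ ‖v₁‖ = 1 ∧ ‖v₂‖ = 1 ∧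
      γ * σ ^ 2 ≤ p₁ * ‖inner ℂ g₁ v₁‖ ^ 2 ∧
      γ * (p₁ * ‖inner ℂ g₂ v₁‖ ^ 2 + σ ^ 2) ≤ p₂ * ‖inner ℂ g₂ v₂‖ ^ 2 ∧
      orderedPower σ γ g₁ g₂ = p₁ + p₂ := by
  have hu := norm_normalize h₂
  have hT := norm_sq_mul_one_add_sinSqAngle_pos hγ h₁ g₂
  have hTe := norm_sq_mul_one_add_sinSqAngle γ h₁ g₂
  have hg₂v := norm_inner_sq_eq_normalize h₂
  have hn : 0 < ‖g₂‖ := norm_pos_iff.2 h₂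
  unfold orderedPower
  rw [hTe] at hT ⊢
  set u := ((‖g₂‖⁻¹ : ℝ) : ℂ) • g₂
  clear_value u
  set T := (1 + γ) * ‖g₁‖ ^ 2 - γ * ‖inner ℂ u g₁‖ ^ 2 with hTdef
  have huu : inner ℂ u u = (1 : ℂ) := by simp [inner_self_eq_norm_sq_to_K, hu]
  have hnn : inner ℂ g₁ u * inner ℂ u g₁ = ((‖inner ℂ u g₁‖ ^ 2 : ℝ) : ℂ) := by
    rw [← inner_conj_symm, Complex.conj_mul']
    push_cast; rfl
  -- `w` realizes equality in `one_add_mul_norm_inner_sq_le`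
  set w := ((1 + γ : ℝ) : ℂ) • g₁ - ((γ : ℝ) * inner ℂ u g₁ : ℂ) • u with hw
  have hgw : inner ℂ g₁ w = (T : ℂ) := by
    rw [hw, inner_sub_right, inner_smul_right, inner_smul_right, inner_self_eq_norm_sq_to_K,
      mul_assoc, mul_comm (inner ℂ u g₁), hnn, hTdef]
    push_cast; rfl
  have huw : inner ℂ u w = inner ℂ u g₁ := by
    rw [hw, inner_sub_right, inner_smul_right, inner_smul_right, huu]
    push_cast; ring
  have hww : ‖w‖ ^ 2 + γ * ‖inner ℂ u g₁‖ ^ 2 = (1 + γ) * T := by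
    have : inner ℂ w w = (((1 + γ) * T - γ * ‖inner ℂ u g₁‖ ^ 2 : ℝ) : ℂ) := by
      conv_lhs => rw [hw, inner_sub_left, inner_smul_left, inner_smul_left, ← hw, hgw, huw, map_mul,
        Complex.conj_ofReal, Complex.conj_ofReal, inner_conj_symm, mul_assoc, hnn]
      push_cast; ring
    have h' : ‖w‖ ^ 2 = (1 + γ) * T - γ * ‖inner ℂ u g₁‖ ^ 2 := by
      apply Complex.ofReal_injective
      rw [← this, inner_self_eq_norm_sq_to_K]
      push_cast; rfl
    linarith
  have hw0 : w ≠ 0 := by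
    intro h0
    rw [h0, inner_zero_right] at hgw
    exact hT.ne' (by exact_mod_cast hgw.symm)
  have hwn : 0 < ‖w‖ := norm_pos_iff.2 hw0
  have hv : ∀ x : EuclideanSpace ℂ (Fin M), ‖inner ℂ x (((‖w‖⁻¹ : ℝ) : ℂ) • w)‖ ^ 2 =
      ‖inner ℂ x w‖ ^ 2 / ‖w‖ ^ 2 := by
    intro x
    rw [inner_smul_right, norm_mul, Complex.norm_real, norm_inv, norm_norm]
    field_simp
  have hgu : ‖inner ℂ g₂ u‖ ^ 2 = ‖g₂‖ ^ 2 := by rw [hg₂v, huu]; simp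
  refine ⟨γ * σ ^ 2 * ‖w‖ ^ 2 / T ^ 2,
    γ * (γ * σ ^ 2 * ‖inner ℂ u g₁‖ ^ 2 / T ^ 2 + σ ^ 2 / ‖g₂‖ ^ 2),
    ((‖w‖⁻¹ : ℝ) : ℂ) • w, u, by positivity, by positivity, norm_normalize hw0, hu, ?_, ?_, ?_⟩
  · rw [hv, hgw, Complex.norm_real, Real.norm_eq_abs, sq_abs]
    apply le_of_eq
    field_simp
  · rw [hv, hg₂v, huw, hgu]
    apply le_of_eq
    field_simp
  · have : (1 + γ) / T = ‖w‖ ^ 2 / T ^ 2 + γ * ‖inner ℂ u g₁‖ ^ 2 / T ^ 2 := by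
      rw [← add_div, hww]
      field_simp
    rw [this]
    ring

lemma downlinkSINR_zero (σ : ℝ) (g : Fin 2 → EuclideanSpace ℂ (Fin M)) (p : Fin 2 → ℝ)
    (v : Fin 2 → EuclideanSpace ℂ (Fin M)) :
    downlinkSINR σ g p v 0 = p 0 * ‖inner ℂ (g 0) (v 0)‖ ^ 2 / σ ^ 2 := by
  have : Finset.Iio (0 : Fin 2) = ∅ := by decide
  simp [downlinkSINR, this]

lemma downlinkSINR_one (σ : ℝ) (g : Fin 2 → EuclideanSpace ℂ (Fin M)) (p : Fin 2 → ℝ)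
    (v : Fin 2 → EuclideanSpace ℂ (Fin M)) :
    downlinkSINR σ g p v 1 =
      p 1 * ‖inner ℂ (g 1) (v 1)‖ ^ 2 / (p 0 * ‖inner ℂ (g 1) (v 0)‖ ^ 2 + σ ^ 2) := by
  have : Finset.Iio (1 : Fin 2) = {0} := by decide
  simp [downlinkSINR, this]

/-- It is best to encode the weaker user first. -/
lemma orderedPower_le_orderedPower_swap {σ γ : ℝ} (hγ : 0 < γ)
    {s f : EuclideanSpace ℂ (Fin M)} (hs : s ≠ 0) (hsf : ‖s‖ ≤ ‖f‖) :
    orderedPower σ γ f s ≤ orderedPower σ γ s f := by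
  unfold orderedPower
  rw [sinSqAngle_span_singleton_comm s f]
  set S := sinSqAngle f (Submodule.span ℂ {s})
  have hS0 : 0 ≤ S := sinSqAngle_span_singleton_nonneg f s
  have hS1 : S ≤ 1 := sinSqAngle_le_one _ _
  have hsn : 0 < ‖s‖ := norm_pos_iff.2 hs
  have hab : 1 / ‖f‖ ^ 2 ≤ 1 / ‖s‖ ^ 2 := by gcongr
  have hc : 1 ≤ (1 + γ) / (1 + γ * S) := by
    rw [le_div_iff₀ (by positivity)]
    nlinarith
  have e : ∀ a : ℝ, (1 + γ) / (a * (1 + γ * S)) = 1 / a * ((1 + γ) / (1 + γ * S)) := by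
    intro a; rw [div_mul_div_comm, one_mul]
  rw [e, e]
  gcongr ?_ * ?_
  nlinarith

/-- The minimum over both encoding orders, for a user `s` that is not stronger than `f`. -/
lemma isLeast_achievablePowers {σ γ : ℝ} (hσ : 0 < σ) (hγ : 0 < γ)
    {s f : EuclideanSpace ℂ (Fin M)} (hs : s ≠ 0) (hf : f ≠ 0) (hsf : ‖s‖ ≤ ‖f‖) :
    IsLeast (achievablePowers σ γ ![s, f]) (orderedPower σ γ f s) := by
  constructor
  · obtain ⟨p₁, p₂, v₁, v₂, hp₁, hp₂, hv₁, hv₂, h₁, h₂, h⟩ :=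
      exists_power_beam_eq_orderedPower hσ hγ hf hs
    refine ⟨Equiv.swap 0 1, ![p₁, p₂], ![v₁, v₂], ?_, ?_, ?_, ?_⟩
    · simp [Fin.forall_fin_two, hp₁, hp₂]
    · simp [Fin.forall_fin_two, hv₁, hv₂]
    · rw [Fin.forall_fin_two, downlinkSINR_zero, downlinkSINR_one, le_div_iff₀ (by positivity),
        le_div_iff₀ (by positivity)]
      exact ⟨by simpa using h₁, by simpa using h₂⟩
    · rw [h]; simp
  · rintro t ⟨π, p, v, hp, hv, hsinr, rfl⟩
    have h0 := hsinr 0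
    have h1 := hsinr 1
    have hp0 := hp 0
    rw [downlinkSINR_zero, le_div_iff₀ (by positivity)] at h0
    rw [downlinkSINR_one, le_div_iff₀ (by positivity)] at h1
    rw [Fin.sum_univ_two]
    have hperm : ∀ π : Equiv.Perm (Fin 2), π = 1 ∨ π = Equiv.swap 0 1 := by decide
    rcases hperm π with rfl | rfl
    · exact (orderedPower_le_orderedPower_swap hγ hs hsf).trans
        (orderedPower_le hγ hs hf (hp 0) (hp 1) (hv 0) (hv 1)
          (by simpa using h0) (by simpa using h1))
    · exact orderedPower_le hγ hf hs (hp 0) (hp 1) (hv 0) (hv 1)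
          (by simpa using h0) (by simpa using h1)

lemma highSINRPower_pair (σ γ : ℝ) (s f : EuclideanSpace ℂ (Fin M)) :
    highSINRPower σ γ ![s, f] = γ * σ ^ 2 *
      (1 / ‖s‖ ^ 2 + 1 / (‖f‖ ^ 2 * sinSqAngle f (Submodule.span ℂ {s}))) := by
  have h0 : Set.Iio (0 : Fin 2) = ∅ := by ext i; fin_cases i <;> simp
  have h1 : Set.Iio (1 : Fin 2) = {0} := by ext i; fin_cases i <;> simp
  unfold highSINRPower
  rw [Fin.sum_univ_two, h0, h1]
  have hs : sinSqAngle s ⊥ = 1 := by simp [sinSqAngle]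
  simp only [Matrix.cons_val_zero, Matrix.cons_val_one, Set.image_empty, Submodule.span_empty,
    Set.image_singleton, hs]
  ring

end Optimization

/-! ### Gamma and Beta laws -/

section RadialLaws

open Set ENNReal

/-- The Gamma distribution with shape parameter `n + 1` and rate `1`. -/
noncomputable def gammaLaw (n : ℕ) : Measure ℝ :=
  (volume.restrict (Ioi 0)).withDensity
    fun x => ENNReal.ofReal (Real.exp (-x) * x ^ n / n.factorial)

/-- The distribution on `(0, 1)` with distribution function `s ↦ s ^ (m + 1)`. -/
noncomputable def powLaw (m : ℕ) : Measure ℝ :=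
  (volume.restrict (Ioo 0 1)).withDensity fun s => ENNReal.ofReal ((m + 1) * s ^ m)

lemma lintegral_gammaLaw (n : ℕ) {φ : ℝ → ℝ≥0∞} (hφ : Measurable φ) :
    ∫⁻ x, φ x ∂gammaLaw n =
      ∫⁻ x in Ioi 0, ENNReal.ofReal (Real.exp (-x) * x ^ n / n.factorial) * φ x := by
  rw [gammaLaw, lintegral_withDensity_eq_lintegral_mul _ (by fun_prop) hφ]
  rfl

lemma lintegral_powLaw (m : ℕ) {φ : ℝ → ℝ≥0∞} (hφ : Measurable φ) :
    ∫⁻ s, φ s ∂powLaw m = ∫⁻ s in Ioo 0 1, ENNReal.ofReal ((m + 1) * s ^ m) * φ s := by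
  rw [powLaw, lintegral_withDensity_eq_lintegral_mul _ (by fun_prop) hφ]
  rfl

instance (n : ℕ) : SigmaFinite (gammaLaw n) := by unfold gammaLaw; infer_instance

instance (m : ℕ) : SigmaFinite (powLaw m) := by unfold powLaw; infer_instance

lemma measurable_complex_mk : Measurable fun z : ℝ × ℝ => (⟨z.1, z.2⟩ : ℂ) :=
  Complex.measurableEquivRealProd.symm.measurable

instance : IsProbabilityMeasure stdComplexGaussian :=
  Measure.isProbabilityMeasure_map measurable_complex_mk.aemeasurable

lemma gaussianPDF_mul_gaussianPDF (x y : ℝ) :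
    gaussianPDF 0 (1 / 2) x * gaussianPDF 0 (1 / 2) y =
      ENNReal.ofReal (Real.pi⁻¹ * Real.exp (-(x ^ 2 + y ^ 2))) := by
  rw [gaussianPDF, gaussianPDF, ← ENNReal.ofReal_mul (gaussianPDFReal_nonneg _ _ _)]
  congr 1
  simp only [gaussianPDFReal, sub_zero]
  have h : (2 * Real.pi * ((1 / 2 : NNReal) : ℝ)) = Real.pi := by push_cast; ring
  have h2 : (2 * ((1 / 2 : NNReal) : ℝ)) = 1 := by push_cast; ring
  rw [h, h2, neg_add, Real.exp_add, div_one, div_one]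
  have hs : (√Real.pi)⁻¹ * (√Real.pi)⁻¹ = Real.pi⁻¹ := by
    rw [← mul_inv, Real.mul_self_sqrt Real.pi_pos.le]
  rw [← hs]; ring

/-- The squared modulus of a standard complex Gaussian is exponentially distributed. -/
lemma lintegral_norm_sq_stdComplexGaussian {φ : ℝ → ℝ≥0∞} (hφ : Measurable φ) :
    ∫⁻ z, φ (‖z‖ ^ 2) ∂stdComplexGaussian = ∫⁻ x, φ x ∂gammaLaw 0 := by
  have hv : (1 / 2 : NNReal) ≠ 0 := by norm_num
  have hn : ∀ p : ℝ × ℝ, ‖(⟨p.1, p.2⟩ : ℂ)‖ ^ 2 = p.1 ^ 2 + p.2 ^ 2 := by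
    intro p; rw [Complex.sq_norm, Complex.normSq_mk]; ring
  unfold stdComplexGaussian
  -- polar coordinates in the plane
  rw [lintegral_map (by fun_prop) measurable_complex_mk, gaussianReal_of_var_ne_zero _ hv,
    prod_withDensity (by fun_prop) (by fun_prop), lintegral_gammaLaw 0 hφ]
  simp only [hn]
  rw [lintegral_withDensity_eq_lintegral_mul _ (by fun_prop) (by fun_prop)]
  simp only [Pi.mul_apply, gaussianPDF_mul_gaussianPDF]
  rw [← Measure.volume_eq_prod, ← lintegral_comp_polarCoord_symm, polarCoord_target,
    Measure.volume_eq_prod, ← Measure.prod_restrict,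
    lintegral_prod _ (by simp only [polarCoord_symm_apply]; fun_prop)]
  have hcs : ∀ r θ : ℝ, (r * Real.cos θ) ^ 2 + (r * Real.sin θ) ^ 2 = r ^ 2 := by
    intro r θ; linear_combination r ^ 2 * Real.sin_sq_add_cos_sq θ
  simp only [polarCoord_symm_apply, hcs, lintegral_const, Measure.restrict_apply_univ,
    Real.volume_Ioo, smul_eq_mul]
  have himg : (fun r : ℝ => r ^ 2) '' Ioi 0 = Ioi 0 := by
    ext x
    refine ⟨?_, fun hx => ⟨√x, Real.sqrt_pos.2 hx, Real.sq_sqrt (le_of_lt hx)⟩⟩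
    rintro ⟨r, hr, rfl⟩
    exact pow_pos (mem_Ioi.1 hr) 2
  conv_rhs => rw [← himg]
  rw [lintegral_image_eq_lintegral_abs_deriv_mul measurableSet_Ioi
    (f' := fun r => 2 * r) (fun r _ => by simpa using (hasDerivAt_pow 2 r).hasDerivWithinAt)]
  · refine setLIntegral_congr_fun measurableSet_Ioi fun r hr => ?_
    have hr : 0 < r := hr
    have hpi := Real.pi_pos
    rw [sub_neg_eq_add, mul_right_comm, ← mul_assoc, ← mul_assoc,
      ← ENNReal.ofReal_mul (by positivity),
      ← ENNReal.ofReal_mul (by positivity), ← ENNReal.ofReal_mul (abs_nonneg _),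
      abs_of_pos (by positivity)]
    congr 2
    simp
    field_simp
    ring
  · intro a ha b hb hab
    exact (pow_left_inj₀ (le_of_lt ha) (le_of_lt hb) two_ne_zero).1 hab

/-- Tonelli's theorem on the region `0 < b < x`. -/
lemma setLIntegral_Ioi_Ioi_swap {F : ℝ → ℝ → ℝ≥0∞} (hF : Measurable (Function.uncurry F)) :
    ∫⁻ b in Ioi (0 : ℝ), ∫⁻ x in Ioi b, F b x = ∫⁻ x in Ioi (0 : ℝ), ∫⁻ b in Ioo 0 x, F b x := by
  have hS : MeasurableSet {p : ℝ × ℝ | 0 < p.1 ∧ p.1 < p.2} :=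
    (measurableSet_lt measurable_const measurable_fst).inter
      (measurableSet_lt measurable_fst measurable_snd)
  have h1 : ∀ b, (Ioi (0 : ℝ)).indicator (fun b => ∫⁻ x in Ioi b, F b x) b =
      ∫⁻ x, {p : ℝ × ℝ | 0 < p.1 ∧ p.1 < p.2}.indicator (Function.uncurry F) (b, x) := by
    intro b
    by_cases hb : b ∈ Ioi (0 : ℝ)
    · rw [indicator_of_mem hb, ← lintegral_indicator measurableSet_Ioi]
      have hb' : 0 < b := hb
      simp only [indicator, mem_Ioi, mem_ofPred_eq, hb', true_and, Function.uncurry]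
    · rw [indicator_of_notMem hb]
      have hb' : ¬ 0 < b := hb
      simp [indicator, hb']
  have h2 : ∀ x, (Ioi (0 : ℝ)).indicator (fun x => ∫⁻ b in Ioo 0 x, F b x) x =
      ∫⁻ b, {p : ℝ × ℝ | 0 < p.1 ∧ p.1 < p.2}.indicator (Function.uncurry F) (b, x) := by
    intro x
    by_cases hx : x ∈ Ioi (0 : ℝ)
    · rw [indicator_of_mem hx, ← lintegral_indicator measurableSet_Ioo]
      simp only [indicator, mem_Ioo, mem_ofPred_eq, Function.uncurry]
      congr!
    · rw [indicator_of_notMem hx]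
      have hx' : ∀ b, ¬ (0 < b ∧ b < x) := fun b hb => hx (hb.1.trans hb.2)
      simp [indicator, hx']
  rw [← lintegral_indicator measurableSet_Ioi, ← lintegral_indicator measurableSet_Ioi]
  simp only [h1, h2]
  exact lintegral_lintegral_swap (hF.indicator hS).aemeasurable

/-- If `a` is exponential and `b` is Gamma distributed with shape `m + 1`, then `a + b` and
`b / (a + b)` are independent, with a Gamma distribution of shape `m + 2` and the distribution
`powLaw m`. -/
lemma lintegral_gammaLaw_prod_gammaLaw (m : ℕ) {φ : ℝ × ℝ → ℝ≥0∞} (hφ : Measurable φ) :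
    ∫⁻ p, φ (p.1 + p.2, p.2 / (p.1 + p.2)) ∂(gammaLaw 0).prod (gammaLaw m) =
      ∫⁻ p, φ p ∂(gammaLaw (m + 1)).prod (powLaw m) := by
  rw [lintegral_prod_symm' _ (by fun_prop), lintegral_prod _ (by fun_prop)]
  rw [lintegral_gammaLaw _ (by fun_prop), lintegral_gammaLaw _ (by fun_prop)]
  -- substitute `x = a + b` for fixed `b`
  have h1 : ∀ b, ∫⁻ a, φ (a + b, b / (a + b)) ∂gammaLaw 0 =
      ∫⁻ x in Ioi b, ENNReal.ofReal (Real.exp (-(x - b))) * φ (x, b / x) := by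
    intro b
    rw [lintegral_gammaLaw _ (by fun_prop)]
    have himg : (fun a : ℝ => a + b) '' Ioi 0 = Ioi b := by simp
    rw [← himg, lintegral_image_eq_lintegral_abs_deriv_mul measurableSet_Ioi
      (f' := fun _ => 1) (fun r _ => ((hasDerivAt_id' r).add_const b).hasDerivWithinAt)
      (add_left_injective b).injOn]
    simp
  -- substitute `b = x s` for fixed `x`
  have h2 : ∀ x ∈ Ioi (0 : ℝ),
      ENNReal.ofReal (Real.exp (-x) * x ^ (m + 1) / (m + 1).factorial) *
        ∫⁻ s, φ (x, s) ∂powLaw m =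
      ∫⁻ b in Ioo 0 x, ENNReal.ofReal (Real.exp (-x) * b ^ m / m.factorial) * φ (x, b / x) := by
    intro x hx
    have hx : 0 < x := hx
    rw [lintegral_powLaw _ (by fun_prop)]
    have himg : (fun s : ℝ => x * s) '' Ioo 0 1 = Ioo 0 x := by
      rw [image_mul_left_Ioo hx]; simp
    rw [← himg, lintegral_image_eq_lintegral_abs_deriv_mul measurableSet_Ioo
      (f' := fun _ => x)
      (fun r _ => by simpa using ((hasDerivAt_id r).const_mul x).hasDerivWithinAt)
      (mul_right_injective₀ hx.ne').injOn, ← lintegral_const_mul _ (by fun_prop)]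
    refine setLIntegral_congr_fun measurableSet_Ioo fun s hs => ?_
    have hs0 : 0 < s := hs.1
    rw [mul_div_cancel_left₀ _ hx.ne', ← mul_assoc, ← mul_assoc,
      ← ENNReal.ofReal_mul (by positivity), ← ENNReal.ofReal_mul (by positivity), abs_of_pos hx]
    congr 2
    rw [Nat.factorial_succ]
    push_cast
    field_simp
    rw [mul_pow]; ring
  rw [setLIntegral_congr_fun measurableSet_Ioi h2]
  rw [← setLIntegral_Ioi_Ioi_swap
    (F := fun b x => ENNReal.ofReal (Real.exp (-x) * b ^ m / m.factorial) * φ (x, b / x))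
    (by fun_prop)]
  refine setLIntegral_congr_fun measurableSet_Ioi fun b hb => ?_
  have hb : 0 < b := hb
  dsimp only
  rw [h1, ← lintegral_const_mul _ (by fun_prop)]
  refine lintegral_congr fun x => ?_
  rw [← mul_assoc, ← ENNReal.ofReal_mul (by positivity)]
  congr 2
  rw [neg_sub, sub_eq_add_neg, Real.exp_add, Real.exp_neg b]
  field_simp

end RadialLaws

/-! ### Unitary invariance of the channel law -/

section ChannelLaw

open Set ENNReal

lemma charFun_stdComplexGaussian (t : ℂ) :
    charFun stdComplexGaussian t = Complex.exp (-(‖t‖ ^ 2 / 4 : ℝ)) := by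
  have hpt : ∀ p : ℝ × ℝ, Complex.exp ((inner ℝ (⟨p.1, p.2⟩ : ℂ) t : ℝ) * Complex.I) =
      Complex.exp (t.re * p.1 * Complex.I) * Complex.exp (t.im * p.2 * Complex.I) := by
    intro p
    rw [← Complex.exp_add]
    congr 1
    rw [Complex.inner]
    simp
    ring
  unfold stdComplexGaussian
  rw [charFun_apply, integral_map measurable_complex_mk.aemeasurable (by fun_prop)]
  simp only [hpt]
  rw [integral_prod_mul (μ := gaussianReal 0 (1 / 2)) (ν := gaussianReal 0 (1 / 2))
    (fun x : ℝ => Complex.exp (t.re * x * Complex.I))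
    (fun x : ℝ => Complex.exp (t.im * x * Complex.I)),
    ← charFun_apply_real, ← charFun_apply_real, charFun_gaussianReal, charFun_gaussianReal,
    ← Complex.exp_add, Complex.sq_norm, Complex.normSq_apply]
  congr 1
  push_cast
  ring

/-- The law of the channel vector of one user. -/
noncomputable def channelLaw (M : ℕ) : Measure (EuclideanSpace ℂ (Fin M)) :=
  (Measure.pi fun _ => stdComplexGaussian).map (WithLp.toLp 2)

instance (M : ℕ) : IsProbabilityMeasure (channelLaw M) :=
  Measure.isProbabilityMeasure_map (by fun_prop)

lemma charFun_channelLaw (M : ℕ) (t : EuclideanSpace ℂ (Fin M)) :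
    charFun (channelLaw M) t = Complex.exp (-(‖t‖ ^ 2 / 4 : ℝ)) := by
  unfold channelLaw
  rw [charFun_pi]
  simp only [charFun_stdComplexGaussian]
  rw [← Complex.exp_sum, EuclideanSpace.norm_sq_eq]
  congr 1
  push_cast
  rw [Finset.sum_neg_distrib, Finset.sum_div]

/-- The law of a channel vector is invariant under unitary maps. -/
lemma channelLaw_map_linearIsometryEquiv (M : ℕ)
    (U : EuclideanSpace ℂ (Fin M) ≃ₗᵢ[ℂ] EuclideanSpace ℂ (Fin M)) :
    (channelLaw M).map U = channelLaw M := by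
  have hU : Measurable U := U.continuous.measurable
  have := Measure.isProbabilityMeasure_map (μ := channelLaw M) hU.aemeasurable
  let V : EuclideanSpace ℂ (Fin M) ≃ₗᵢ[ℝ] EuclideanSpace ℂ (Fin M) :=
    { toLinearEquiv := U.toLinearEquiv.restrictScalars ℝ, norm_map' := U.norm_map }
  refine Measure.ext_of_charFun (funext fun t => ?_)
  have hin : ∀ x, inner ℝ (U x) t = inner ℝ x (V.symm t) := fun x => V.inner_map_eq_flip x t
  rw [charFun_apply, integral_map hU.aemeasurable (by fun_prop)]
  simp only [hin]
  rw [← charFun_apply, charFun_channelLaw, charFun_channelLaw, V.symm.norm_map]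

end ChannelLaw

/-! ### Joint law of norms and angles -/

section JointLaws

open Set ENNReal

/-- Tonelli's theorem isolating one coordinate of a finite product. -/
lemma lintegral_pi_insertNth {α : Type*} [MeasurableSpace α] (μ : Measure α) [SigmaFinite μ]
    {n : ℕ} (i : Fin (n + 1)) {F : (Fin (n + 1) → α) → ℝ≥0∞} (hF : Measurable F) :
    ∫⁻ x, F x ∂Measure.pi (fun _ => μ) =
      ∫⁻ a, ∫⁻ y, F (i.insertNth (α := fun _ => α) a y) ∂Measure.pi (fun _ : Fin n => μ) ∂μ := by
  have hmp := (measurePreserving_piFinSuccAbove (fun _ : Fin (n + 1) => μ) i).symm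
  rw [← hmp.lintegral_comp hF]
  exact lintegral_prod _
    (hF.comp (MeasurableEquiv.piFinSuccAbove (fun _ => α) i).symm.measurable).aemeasurable

lemma lintegral_Ioo_zero_pow (m : ℕ) {x : ℝ} (hx : 0 ≤ x) :
    ∫⁻ s in Ioo 0 x, ENNReal.ofReal ((m + 1) * s ^ m) = ENNReal.ofReal (x ^ (m + 1)) := by
  have hint : IntervalIntegrable (fun s : ℝ => (m + 1) * s ^ m) volume 0 x :=
    (by fun_prop : Continuous fun s : ℝ => (m + 1) * s ^ m).intervalIntegrable _ _
  rw [← ofReal_integral_eq_lintegral_ofReal, ← integral_Ioc_eq_integral_Ioo,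
    ← intervalIntegral.integral_of_le hx]
  · rw [intervalIntegral.integral_const_mul, integral_pow, zero_pow (Nat.succ_ne_zero m)]
    congr 1
    have : (m + 1 : ℝ) ≠ 0 := by positivity
    field_simp
    ring
  · exact ((intervalIntegrable_iff_integrableOn_Ioc_of_le hx).1 hint).mono_set Ioo_subset_Ioc_self
  · filter_upwards [ae_restrict_mem measurableSet_Ioo] with s hs
    have := hs.1
    positivity

instance (m : ℕ) : IsProbabilityMeasure (powLaw m) where
  measure_univ := by
    rw [← lintegral_one, lintegral_powLaw m measurable_const]
    simp [lintegral_Ioo_zero_pow m zero_le_one]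

/-- The energy of `n + 1` independent complex Gaussians is Gamma distributed. -/
lemma lintegral_sum_norm_sq (n : ℕ) {φ : ℝ → ℝ≥0∞} (hφ : Measurable φ) :
    ∫⁻ z : Fin (n + 1) → ℂ, φ (∑ i, ‖z i‖ ^ 2) ∂Measure.pi (fun _ => stdComplexGaussian) =
      ∫⁻ x, φ x ∂gammaLaw n := by
  induction n generalizing φ with
  | zero =>
    rw [lintegral_pi_insertNth _ 0 (by fun_prop), ← lintegral_norm_sq_stdComplexGaussian hφ]
    simp
  | succ n ih =>
    rw [lintegral_pi_insertNth _ 0 (by fun_prop)]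
    simp only [Fin.sum_univ_succ (n := n + 1), Fin.insertNth_zero, Fin.cons_zero, Fin.cons_succ]
    have h1 : ∀ a : ℂ, ∫⁻ y : Fin (n + 1) → ℂ, φ (‖a‖ ^ 2 + ∑ i, ‖y i‖ ^ 2)
        ∂Measure.pi (fun _ => stdComplexGaussian) = ∫⁻ b, φ (‖a‖ ^ 2 + b) ∂gammaLaw n :=
      fun a => ih (φ := fun b => φ (‖a‖ ^ 2 + b)) (by fun_prop)
    refine (lintegral_congr h1).trans ?_
    rw [lintegral_norm_sq_stdComplexGaussian (φ := fun x => ∫⁻ b, φ (x + b) ∂gammaLaw n)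
      (Measurable.lintegral_prod_right' (f := fun p : ℝ × ℝ => φ (p.1 + p.2)) (by fun_prop)),
      ← lintegral_prod (fun p : ℝ × ℝ => φ (p.1 + p.2)) (by fun_prop),
      lintegral_gammaLaw_prod_gammaLaw n (φ := fun p => φ p.1) (by fun_prop),
      lintegral_prod _ (by fun_prop)]
    simp

instance (n : ℕ) : IsProbabilityMeasure (gammaLaw n) where
  measure_univ := by
    rw [← lintegral_one, ← lintegral_sum_norm_sq n measurable_const]
    simp

lemma ae_gammaLaw_pos (n : ℕ) : ∀ᵐ x ∂gammaLaw n, 0 < x :=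
  (withDensity_absolutelyContinuous _ _).ae_le (ae_restrict_mem measurableSet_Ioi)

/-- The joint law of the energy of a channel vector and of the fraction of it that lies outside the
first coordinate. -/
lemma lintegral_channelLaw_coord (m : ℕ) {φ : ℝ × ℝ → ℝ≥0∞} (hφ : Measurable φ) :
    ∫⁻ y, φ (‖y‖ ^ 2, 1 - ‖y 0‖ ^ 2 / ‖y‖ ^ 2) ∂channelLaw (m + 2) =
      ∫⁻ p, φ p ∂(gammaLaw (m + 1)).prod (powLaw m) := by
  unfold channelLaw
  rw [lintegral_map (by fun_prop) (by fun_prop)]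
  simp only [EuclideanSpace.norm_sq_eq]
  rw [lintegral_pi_insertNth _ 0 (by fun_prop)]
  simp only [Fin.sum_univ_succ (n := m + 1), Fin.insertNth_zero, Fin.cons_zero, Fin.cons_succ]
  have h1 : ∀ a : ℂ, ∫⁻ y : Fin (m + 1) → ℂ, φ (‖a‖ ^ 2 + ∑ i, ‖y i‖ ^ 2,
      1 - ‖a‖ ^ 2 / (‖a‖ ^ 2 + ∑ i, ‖y i‖ ^ 2)) ∂Measure.pi (fun _ => stdComplexGaussian) =
      ∫⁻ b, φ (‖a‖ ^ 2 + b, 1 - ‖a‖ ^ 2 / (‖a‖ ^ 2 + b)) ∂gammaLaw m :=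
    fun a => lintegral_sum_norm_sq m
      (φ := fun b => φ (‖a‖ ^ 2 + b, 1 - ‖a‖ ^ 2 / (‖a‖ ^ 2 + b))) (by fun_prop)
  refine (lintegral_congr h1).trans ?_
  rw [lintegral_norm_sq_stdComplexGaussian
    (φ := fun x => ∫⁻ b, φ (x + b, 1 - x / (x + b)) ∂gammaLaw m)
    (Measurable.lintegral_prod_right' (f := fun p : ℝ × ℝ => φ (p.1 + p.2, 1 - p.1 / (p.1 + p.2)))
      (by fun_prop)),
    ← lintegral_gammaLaw_prod_gammaLaw m hφ, lintegral_prod _ (by fun_prop)]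
  refine lintegral_congr_ae ?_
  filter_upwards [ae_gammaLaw_pos 0] with x hx
  refine lintegral_congr_ae ?_
  filter_upwards [ae_gammaLaw_pos m] with b hb
  have : x + b ≠ 0 := by positivity
  congr 2
  field_simp
  ring

/-- Any unit vector can be rotated to the first basis vector. -/
lemma exists_linearIsometryEquiv_apply_zero (n : ℕ) {f : EuclideanSpace ℂ (Fin (n + 1))}
    (hf : f ≠ 0) :
    ∃ U : EuclideanSpace ℂ (Fin (n + 1)) ≃ₗᵢ[ℂ] EuclideanSpace ℂ (Fin (n + 1)),
      ∀ y, ‖U y 0‖ = ‖inner ℂ f y‖ / ‖f‖ := by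
  have hu := norm_normalize hf
  have ho : Orthonormal ℂ (({0} : Set (Fin (n + 1))).domRestrict
      fun _ => ((‖f‖⁻¹ : ℝ) : ℂ) • f) := by
    refine ⟨fun _ => hu, fun i j hij => (hij (Subsingleton.elim i j)).elim⟩
  obtain ⟨b, hb⟩ := ho.exists_orthonormalBasis_extension_of_card_eq (by simp)
  refine ⟨b.repr, fun y => ?_⟩
  rw [b.repr_apply_apply, hb 0 rfl, inner_normalize, norm_mul, Complex.norm_real, norm_inv,
    norm_norm, div_eq_inv_mul]

lemma measurable_sinSqAngle_left {M : ℕ} (f : EuclideanSpace ℂ (Fin M)) :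
    Measurable fun y => sinSqAngle y (Submodule.span ℂ {f}) := by
  simp only [sinSqAngle_span_singleton]
  have : Measurable fun y => inner ℂ f y :=
    (by fun_prop : Continuous fun y => inner ℂ f y).measurable
  fun_prop

/-- The norm of a channel vector is independent of its angle with a fixed direction. -/
lemma channelLaw_map_norm_sq_sinSqAngle (m : ℕ) {f : EuclideanSpace ℂ (Fin (m + 2))}
    (hf : f ≠ 0) :
    (channelLaw (m + 2)).map (fun y => (‖y‖ ^ 2, sinSqAngle y (Submodule.span ℂ {f}))) =
      (gammaLaw (m + 1)).prod (powLaw m) := by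
  have hS := measurable_sinSqAngle_left f
  refine Measure.ext_of_lintegral _ fun φ hφ => ?_
  obtain ⟨U, hU⟩ := exists_linearIsometryEquiv_apply_zero (m + 1) hf
  have hUm : Measurable U := U.continuous.measurable
  rw [lintegral_map hφ (by fun_prop), ← lintegral_channelLaw_coord m hφ]
  conv_rhs => rw [← channelLaw_map_linearIsometryEquiv (m + 2) U]
  rw [lintegral_map (by fun_prop) hUm]
  refine lintegral_congr fun y => ?_
  rw [hU, U.norm_map, sinSqAngle_span_singleton, div_pow, div_div]

/-- For independent channel vectors, all the norms and all the angles with a fixed direction are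
independent. -/
lemma lintegral_pi_channelLaw (m n : ℕ) {f : EuclideanSpace ℂ (Fin (m + 2))} (hf : f ≠ 0)
    {Φ : (Fin n → ℝ) × (Fin n → ℝ) → ℝ≥0∞} (hΦ : Measurable Φ) :
    ∫⁻ y, Φ (fun k => ‖y k‖ ^ 2, fun k => sinSqAngle (y k) (Submodule.span ℂ {f}))
        ∂Measure.pi (fun _ : Fin n => channelLaw (m + 2)) =
      ∫⁻ p, Φ p ∂(Measure.pi fun _ : Fin n => gammaLaw (m + 1)).prod
        (Measure.pi fun _ : Fin n => powLaw m) := by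
  have hS := measurable_sinSqAngle_left f
  have hpair : Measurable fun y : EuclideanSpace ℂ (Fin (m + 2)) =>
    (‖y‖ ^ 2, sinSqAngle y (Submodule.span ℂ {f})) := by fun_prop
  have hmap := channelLaw_map_norm_sq_sinSqAngle m hf
  have : IsProbabilityMeasure ((channelLaw (m + 2)).map
    fun y => (‖y‖ ^ 2, sinSqAngle y (Submodule.span ℂ {f}))) := by rw [hmap]; infer_instance
  have hpi := Measure.pi_map_pi (μ := fun _ : Fin n => channelLaw (m + 2))
    (f := fun _ y => (‖y‖ ^ 2, sinSqAngle y (Submodule.span ℂ {f})))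
    (fun _ => hpair.aemeasurable)
  simp only [hmap] at hpi
  have hmp := measurePreserving_arrowProdEquivProdArrow ℝ ℝ (Fin n) (fun _ => gammaLaw (m + 1))
    (fun _ => powLaw m)
  rw [← hmp.lintegral_comp hΦ, ← hpi]
  have hg : Measurable fun (y : Fin n → EuclideanSpace ℂ (Fin (m + 2))) k =>
      (‖y k‖ ^ 2, sinSqAngle (y k) (Submodule.span ℂ {f})) :=
    measurable_pi_lambda _ fun k => hpair.comp (measurable_pi_apply k)
  exact (lintegral_map (hΦ.comp hmp.measurable) hg).symm

/-- The channel vectors of the users are independent. -/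
lemma IsGaussianChannel.hasLaw {Ω : Type*} [MeasurableSpace Ω] {P : Measure Ω} {M K : ℕ}
    {h : Fin K → Ω → EuclideanSpace ℂ (Fin M)} (hh : IsGaussianChannel P h) :
    HasLaw (fun ω k => h k ω) (Measure.pi fun _ => channelLaw M) P := by
  have h1 := hh.indep.hasLaw_pi (fun e : Fin K × Fin M => hh.law e.1 e.2)
  have h2 : MeasurePreserving (MeasurableEquiv.curry (Fin K) (Fin M) ℂ)
      (Measure.pi fun _ => stdComplexGaussian)
      (Measure.pi fun _ => Measure.pi fun _ => stdComplexGaussian) := by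
    refine ⟨MeasurableEquiv.measurable _, ?_⟩
    simp only [← Measure.infinitePi_eq_pi]
    exact Measure.infinitePi_map_curry (fun _ _ => stdComplexGaussian)
  have h3 : MeasurePreserving (fun (x : Fin K → Fin M → ℂ) k => WithLp.toLp 2 (x k))
      (Measure.pi fun _ => Measure.pi fun _ => stdComplexGaussian)
      (Measure.pi fun _ => channelLaw M) :=
    measurePreserving_pi _ _ fun _ => ⟨by fun_prop, rfl⟩
  exact (h3.comp h2).comp_hasLaw h1

end JointLaws

/-! ### Factorization over selection events -/

section SelectionEvent

open Set ENNReal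

variable {m n : ℕ}

/-- The event that user `i` has the largest channel norm and that, among the others, the user
`i.succAbove l` is the most orthogonal to it, without ties. -/
def selectionEvent (m n : ℕ) (i : Fin (n + 2)) (l : Fin (n + 1)) :
    Set (Fin (n + 2) → EuclideanSpace ℂ (Fin (m + 2))) :=
  {x | (∀ k, ‖x (i.succAbove k)‖ ^ 2 < ‖x i‖ ^ 2) ∧
    ∀ k, sinSqAngle (x (i.succAbove (l.succAbove k))) (Submodule.span ℂ {x i}) <
      sinSqAngle (x (i.succAbove l)) (Submodule.span ℂ {x i})}

lemma measurable_sinSqAngle_apply {M K : ℕ} (i j : Fin K) :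
    Measurable fun x : Fin K → EuclideanSpace ℂ (Fin M) =>
      sinSqAngle (x i) (Submodule.span ℂ {x j}) := by
  simp only [sinSqAngle_span_singleton]
  have : Measurable fun x : Fin K → EuclideanSpace ℂ (Fin M) => inner ℂ (x j) (x i) :=
    (by fun_prop : Continuous fun x : Fin K → EuclideanSpace ℂ (Fin M) =>
      inner ℂ (x j) (x i)).measurable
  fun_prop

lemma measurableSet_forall_lt {α ι : Type*} [MeasurableSpace α] [Countable ι] {f g : ι → α → ℝ}
    (hf : ∀ k, Measurable (f k)) (hg : ∀ k, Measurable (g k)) :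
    MeasurableSet {x | ∀ k, f k x < g k x} := by
  rw [ofPred_forall]
  exact .iInter fun k => measurableSet_lt (hf k) (hg k)

lemma measurableSet_selectionEvent (i : Fin (n + 2)) (l : Fin (n + 1)) :
    MeasurableSet (selectionEvent m n i l) := by
  exact (measurableSet_forall_lt (fun k => by fun_prop) (fun k => by fun_prop)).inter
    (measurableSet_forall_lt (fun k => measurable_sinSqAngle_apply _ _)
      (fun k => measurable_sinSqAngle_apply _ _))

lemma lintegral_norm_sq_channelLaw (m : ℕ) {φ : ℝ → ℝ≥0∞} (hφ : Measurable φ) :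
    ∫⁻ y, φ (‖y‖ ^ 2) ∂channelLaw (m + 2) = ∫⁻ x, φ x ∂gammaLaw (m + 1) := by
  rw [lintegral_channelLaw_coord m (φ := fun p => φ p.1) (by fun_prop),
    lintegral_prod _ (by fun_prop)]
  simp

lemma ae_channelLaw_ne_zero (m : ℕ) : ∀ᵐ y ∂channelLaw (m + 2), y ≠ 0 := by
  have hmap : (channelLaw (m + 2)).map (fun y => ‖y‖ ^ 2) = gammaLaw (m + 1) :=
    Measure.ext_of_lintegral _ fun φ hφ => by
      rw [lintegral_map hφ (by fun_prop), lintegral_norm_sq_channelLaw m hφ]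
  have h := ae_gammaLaw_pos (m + 1)
  rw [← hmap] at h
  filter_upwards [ae_of_ae_map (by fun_prop) h] with y hy h0
  simp [h0] at hy

/-- The norms of all the channel vectors are independent of the angles of the others with the
channel vector of user `i`. -/
lemma lintegral_pi_norm_sq_mul_sinSqAngle (i : Fin (n + 2))
    {A : ℝ × (Fin (n + 1) → ℝ) → ℝ≥0∞} (hA : Measurable A)
    {B : (Fin (n + 1) → ℝ) → ℝ≥0∞} (hB : Measurable B) :
    ∫⁻ x, A (‖x i‖ ^ 2, fun k => ‖x (i.succAbove k)‖ ^ 2) *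
        B (fun k => sinSqAngle (x (i.succAbove k)) (Submodule.span ℂ {x i}))
        ∂Measure.pi (fun _ => channelLaw (m + 2)) =
      (∫⁻ r, ∫⁻ X, A (r, X) ∂Measure.pi (fun _ => gammaLaw (m + 1)) ∂gammaLaw (m + 1)) *
        ∫⁻ S, B S ∂Measure.pi (fun _ => powLaw m) := by
  have hS : Measurable fun x : Fin (n + 2) → EuclideanSpace ℂ (Fin (m + 2)) =>
      fun k => sinSqAngle (x (i.succAbove k)) (Submodule.span ℂ {x i}) :=
    measurable_pi_lambda _ fun k => measurable_sinSqAngle_apply _ _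
  have hAx : Measurable fun x : Fin (n + 2) → EuclideanSpace ℂ (Fin (m + 2)) =>
      A (‖x i‖ ^ 2, fun k => ‖x (i.succAbove k)‖ ^ 2) := by fun_prop
  refine (lintegral_pi_insertNth _ i (hAx.mul (hB.comp hS))).trans ?_
  simp only [Pi.mul_apply, Function.comp_apply, Fin.insertNth_apply_same,
    Fin.insertNth_apply_succAbove]
  have hinner : Measurable fun r => ∫⁻ X, A (r, X) ∂Measure.pi (fun _ => gammaLaw (m + 1)) :=
    hA.lintegral_prod_right'
  rw [← lintegral_norm_sq_channelLaw m hinner, ← lintegral_mul_const _ (by fun_prop)]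
  refine lintegral_congr_ae ?_
  filter_upwards [ae_channelLaw_ne_zero m] with f hf
  rw [lintegral_pi_channelLaw m (n + 1) hf (Φ := fun p => A (‖f‖ ^ 2, p.1) * B p.2)
    (by fun_prop)]
  exact lintegral_prod_mul (f := fun X => A (‖f‖ ^ 2, X)) (g := B)
    (by fun_prop) (by fun_prop)

lemma measurableSet_forall_succAbove_lt (l : Fin (n + 1)) :
    MeasurableSet {S : Fin (n + 1) → ℝ | ∀ k, S (l.succAbove k) < S l} :=
  measurableSet_forall_lt (fun k => by fun_prop) (fun k => by fun_prop)

lemma pi_forall_lt (μ : Measure ℝ) [IsProbabilityMeasure μ] (s : ℝ) :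
    Measure.pi (fun _ : Fin n => μ) {y | ∀ k, y k < s} = μ (Iio s) ^ n := by
  have : {y : Fin n → ℝ | ∀ k, y k < s} = univ.pi fun _ => Iio s := by ext; simp
  rw [this, Measure.pi_pi]
  simp

/-- The largest of independent variables, when it is the one with index `l`: the others are below
its value. -/
lemma lintegral_indicator_argmax (μ : Measure ℝ) [IsProbabilityMeasure μ] (l : Fin (n + 1))
    {χ : ℝ → ℝ≥0∞} (hχ : Measurable χ) :
    ∫⁻ S, {S : Fin (n + 1) → ℝ | ∀ k, S (l.succAbove k) < S l}.indicator (fun S => χ (S l)) S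
      ∂Measure.pi (fun _ => μ) = ∫⁻ s, χ s * μ (Iio s) ^ n ∂μ := by
  have hm : Measurable fun S : Fin (n + 1) → ℝ => χ (S l) := by fun_prop
  rw [lintegral_pi_insertNth _ l (hm.indicator (measurableSet_forall_succAbove_lt l))]
  refine lintegral_congr fun s => ?_
  have hset : MeasurableSet {y : Fin n → ℝ | ∀ k, y k < s} :=
    measurableSet_forall_lt (fun k => by fun_prop) (fun k => by fun_prop)
  rw [← pi_forall_lt μ s, ← lintegral_indicator_const hset]
  refine lintegral_congr fun y => ?_
  simp [indicator]

lemma lintegral_indicator_forall_lt (μ : Measure ℝ) [IsProbabilityMeasure μ] (l : Fin (n + 1))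
    (r : ℝ) {ψ : ℝ → ℝ≥0∞} (hψ : Measurable ψ) :
    ∫⁻ X, {X : Fin (n + 1) → ℝ | ∀ k, X k < r}.indicator (fun X => ψ (X l)) X
      ∂Measure.pi (fun _ => μ) = (∫⁻ t in Iio r, ψ t ∂μ) * μ (Iio r) ^ n := by
  have hset : ∀ n : ℕ, MeasurableSet {y : Fin n → ℝ | ∀ k, y k < r} := fun n =>
    measurableSet_forall_lt (fun k => by fun_prop) (fun k => by fun_prop)
  have hm : Measurable fun X : Fin (n + 1) → ℝ => ψ (X l) := by fun_prop
  rw [lintegral_pi_insertNth _ l (hm.indicator (hset _)),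
    ← lintegral_indicator measurableSet_Iio,
    ← lintegral_mul_const _ (hψ.indicator measurableSet_Iio)]
  refine lintegral_congr fun t => ?_
  rw [← pi_forall_lt μ r, ← lintegral_indicator_const (hset n)]
  refine lintegral_congr fun y => ?_
  simp only [indicator, mem_ofPred_eq, Fin.forall_iff_succAbove l, Fin.insertNth_apply_same,
    Fin.insertNth_apply_succAbove, mem_Iio]
  split_ifs <;> simp_all

/-- Expectations over a selection event factorize into an integral over the norms and an integral
over the angle. -/
lemma setLIntegral_selectionEvent (i : Fin (n + 2)) (l : Fin (n + 1)) {ψ : ℝ × ℝ → ℝ≥0∞}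
    (hψ : Measurable ψ) {χ : ℝ → ℝ≥0∞} (hχ : Measurable χ) :
    ∫⁻ x in selectionEvent m n i l, ψ (‖x i‖ ^ 2, ‖x (i.succAbove l)‖ ^ 2) *
        χ (sinSqAngle (x (i.succAbove l)) (Submodule.span ℂ {x i}))
        ∂Measure.pi (fun _ => channelLaw (m + 2)) =
      (∫⁻ r, (∫⁻ t in Iio r, ψ (r, t) ∂gammaLaw (m + 1)) * gammaLaw (m + 1) (Iio r) ^ n
        ∂gammaLaw (m + 1)) * ∫⁻ s, χ s * powLaw m (Iio s) ^ n ∂powLaw m := by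
  have hAset : MeasurableSet {p : ℝ × (Fin (n + 1) → ℝ) | ∀ k, p.2 k < p.1} :=
    measurableSet_forall_lt (fun k => by fun_prop) (fun k => by fun_prop)
  have key := lintegral_pi_norm_sq_mul_sinSqAngle (m := m) i
    (A := {p : ℝ × (Fin (n + 1) → ℝ) | ∀ k, p.2 k < p.1}.indicator fun p => ψ (p.1, p.2 l))
    (Measurable.indicator (by fun_prop) hAset)
    (B := {S : Fin (n + 1) → ℝ | ∀ k, S (l.succAbove k) < S l}.indicator fun S => χ (S l))
    (Measurable.indicator (by fun_prop) (measurableSet_forall_succAbove_lt l))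
  rw [lintegral_indicator_argmax _ _ hχ] at key
  rw [← lintegral_indicator (measurableSet_selectionEvent i l)]
  refine Eq.trans (lintegral_congr fun x => ?_) (key.trans ?_)
  · simp only [selectionEvent, indicator, mem_ofPred_eq]
    by_cases h1 : ∀ k, ‖x (i.succAbove k)‖ ^ 2 < ‖x i‖ ^ 2 <;>
    by_cases h2 : ∀ k, sinSqAngle (x (i.succAbove (l.succAbove k))) (Submodule.span ℂ {x i}) <
      sinSqAngle (x (i.succAbove l)) (Submodule.span ℂ {x i}) <;>
    simp [h1, h2]
  · congr 1
    refine lintegral_congr fun r => ?_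
    exact lintegral_indicator_forall_lt _ l r (ψ := fun t => ψ (r, t)) (by fun_prop)

end SelectionEvent

/-! ### The integrals over norms and angles -/

section Constants

open Set ENNReal Filter Topology

lemma measurable_measure_Iio_pow (μ : Measure ℝ) (n : ℕ) :
    Measurable fun s => μ (Iio s) ^ n := by
  have : Monotone fun s => μ (Iio s) := fun a b hab => measure_mono (Iio_subset_Iio hab)
  exact this.measurable.pow_const n

lemma powLaw_Iio (m : ℕ) {x : ℝ} (hx : x ∈ Ioo (0 : ℝ) 1) :
    powLaw m (Iio x) = ENNReal.ofReal (x ^ (m + 1)) := by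
  rw [powLaw, withDensity_apply _ measurableSet_Iio, Measure.restrict_restrict measurableSet_Iio,
    ← lintegral_Ioo_zero_pow m hx.1.le]
  congr 2
  ext s
  simp only [mem_inter_iff, mem_Iio, mem_Ioo]
  exact ⟨fun h => ⟨h.2.1, h.1⟩, fun h => ⟨h.2, h.1, h.2.trans hx.2⟩⟩

lemma setLIntegral_Ioo_const_mul_pow {c : ℝ} (hc : 0 ≤ c) (q : ℕ) :
    ∫⁻ s in Ioo (0 : ℝ) 1, ENNReal.ofReal (c * s ^ q) = ENNReal.ofReal (c / (q + 1)) := by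
  have hq : (q + 1 : ℝ) ≠ 0 := by positivity
  have h : ∀ s : ℝ, ENNReal.ofReal (c * s ^ q) =
      ENNReal.ofReal (c / (q + 1)) * ENNReal.ofReal ((q + 1) * s ^ q) := by
    intro s
    rw [← ENNReal.ofReal_mul (by positivity)]
    congr 1
    field_simp
  simp only [h]
  rw [lintegral_const_mul _ (by fun_prop), lintegral_Ioo_zero_pow q zero_le_one]
  simp

/-- The probability that a given one of `n + 1` independent angles is the largest. -/
lemma lintegral_powLaw_pow_Iio (m n : ℕ) :
    ∫⁻ s, 1 * powLaw m (Iio s) ^ n ∂powLaw m = ENNReal.ofReal (1 / (n + 1)) := by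
  have hG := measurable_measure_Iio_pow (powLaw m) n
  rw [lintegral_powLaw m (by fun_prop)]
  have h := setLIntegral_Ioo_const_mul_pow (c := m + 1) (by positivity) (m + (m + 1) * n)
  rw [show ((m : ℝ) + 1) / ((m + (m + 1) * n : ℕ) + 1) = 1 / (n + 1) by
    push_cast; field_simp; ring] at h
  rw [← h]
  refine setLIntegral_congr_fun measurableSet_Ioo fun s hs => ?_
  have hs0 := hs.1
  rw [powLaw_Iio m hs, one_mul, ← ENNReal.ofReal_pow (by positivity),
    ← ENNReal.ofReal_mul (by positivity)]
  congr 1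
  ring

/-- The mean inverse `sin²` of one of `n + 1` independent angles, restricted to the event that it is
the largest. For `n = 0` it is finite only if `0 < m`. -/
lemma lintegral_powLaw_inv_mul_pow_Iio (m n : ℕ) (h : 1 < (m + 1) * (n + 1)) :
    ∫⁻ s, (ENNReal.ofReal s)⁻¹ * powLaw m (Iio s) ^ n ∂powLaw m =
      ENNReal.ofReal ((m + 1) / ((m + 1) * (n + 1) - 1)) := by
  have hG := measurable_measure_Iio_pow (powLaw m) n
  rw [lintegral_powLaw m (by fun_prop)]
  obtain ⟨q, hq⟩ : ∃ q, m + (m + 1) * n = q + 1 :=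
    Nat.exists_eq_succ_of_ne_zero (by rintro h0; nlinarith)
  have h := setLIntegral_Ioo_const_mul_pow (c := m + 1) (by positivity) q
  rw [show (q : ℝ) + 1 = (m + 1) * (n + 1) - 1 by
    have : (m : ℝ) + (m + 1) * n = q + 1 := by exact_mod_cast hq
    linarith] at h
  rw [← h]
  refine setLIntegral_congr_fun measurableSet_Ioo fun s hs => ?_
  have hs0 : 0 < s := hs.1
  rw [powLaw_Iio m hs, ← ENNReal.ofReal_inv_of_pos hs0, ← ENNReal.ofReal_pow (by positivity),
    ← ENNReal.ofReal_mul (by positivity), ← ENNReal.ofReal_mul (by positivity)]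
  congr 1
  have e : s ^ m * (s ^ (m + 1)) ^ n = s ^ q * s := by
    rw [← pow_mul, ← pow_add, hq, pow_succ]
  calc ((m : ℝ) + 1) * s ^ m * (s⁻¹ * (s ^ (m + 1)) ^ n)
      = (m + 1) * (s ^ m * (s ^ (m + 1)) ^ n) * s⁻¹ := by ring
    _ = (m + 1) * s ^ q := by rw [e]; field_simp

instance (n : ℕ) : NullSingletonClass (gammaLaw n) where
  measure_singleton x := withDensity_absolutelyContinuous _ _ (by simp)

lemma hasDerivAt_regGamma (n : ℕ) (x : ℝ) :
    HasDerivAt (regGamma (n + 1)) (Real.exp (-x) * x ^ n / n.factorial) x := by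
  unfold regGamma
  have hc : Continuous fun t : ℝ => Real.exp (-t) * t ^ (n + 1 - 1) := by fun_prop
  have := (intervalIntegral.integral_hasDerivAt_right (hc.intervalIntegrable 0 x)
    (hc.stronglyMeasurableAtFilter _ _) hc.continuousAt).const_mul (1 / Real.Gamma (n + 1 : ℕ))
  refine this.congr_deriv ?_
  rw [Nat.add_sub_cancel, Nat.cast_succ, Real.Gamma_nat_eq_factorial]
  ring

lemma continuous_regGamma (n : ℕ) : Continuous (regGamma (n + 1)) :=
  continuous_iff_continuousAt.2 fun x => (hasDerivAt_regGamma n x).continuousAt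

lemma regGamma_nonneg (n : ℕ) {x : ℝ} (hx : 0 ≤ x) : 0 ≤ regGamma (n + 1) x := by
  unfold regGamma
  have : 0 < Real.Gamma (n + 1 : ℕ) := Real.Gamma_pos_of_pos (by positivity)
  refine mul_nonneg (by positivity) (intervalIntegral.integral_nonneg hx fun t ht => ?_)
  have := ht.1
  positivity

/-- `regGamma (n + 1)` is the distribution function of `gammaLaw n`. -/
lemma gammaLaw_Iio (n : ℕ) {x : ℝ} (hx : 0 ≤ x) :
    gammaLaw n (Iio x) = ENNReal.ofReal (regGamma (n + 1) x) := by
  have hc : Continuous fun t : ℝ => Real.exp (-t) * t ^ n / n.factorial := by fun_prop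
  have hset : Iio x ∩ Ioi 0 = Ioo 0 x := by rw [inter_comm, Ioi_inter_Iio]
  rw [gammaLaw, withDensity_apply _ measurableSet_Iio, Measure.restrict_restrict measurableSet_Iio,
    hset, ← ofReal_integral_eq_lintegral_ofReal, ← integral_Ioc_eq_integral_Ioo,
    ← intervalIntegral.integral_of_le hx]
  · rw [intervalIntegral.integral_eq_sub_of_hasDerivAt (fun t _ => hasDerivAt_regGamma n t)
      (hc.intervalIntegrable 0 x)]
    simp [regGamma]
  · exact ((intervalIntegrable_iff_integrableOn_Ioc_of_le hx).1
      (hc.intervalIntegrable 0 x)).mono_set Ioo_subset_Ioc_self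
  · filter_upwards [ae_restrict_mem measurableSet_Ioo] with s hs
    have := hs.1
    positivity

lemma tendsto_regGamma_atTop (n : ℕ) : Tendsto (regGamma (n + 1)) atTop (𝓝 1) := by
  have h1 : Tendsto (fun x : ℝ => gammaLaw n (Iic x)) atTop (𝓝 1) := by
    simpa using tendsto_measure_Iic_atTop (gammaLaw n)
  have h2 := (ENNReal.tendsto_toReal one_ne_top).comp h1
  refine h2.congr' ?_
  filter_upwards [eventually_ge_atTop 0] with x hx
  rw [Function.comp_apply, ← measure_congr Iio_ae_eq_Iic, gammaLaw_Iio n hx,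
    ENNReal.toReal_ofReal (regGamma_nonneg n hx)]

/-- The probability that, of `n + 1` independent Gamma variables, the first exceeds `t` and all the
others. -/
lemma setLIntegral_Ioi_gammaLaw_pow (k n : ℕ) {t : ℝ} (ht : 0 ≤ t) :
    ∫⁻ r in Ioi t, gammaLaw k (Iio r) ^ n ∂gammaLaw k =
      ENNReal.ofReal ((1 - regGamma (k + 1) t ^ (n + 1)) / (n + 1)) := by
  set f : ℝ → ℝ := fun r => Real.exp (-r) * r ^ k / k.factorial * regGamma (k + 1) r ^ n with hf
  have hnn : ∀ r ∈ Ioi t, 0 ≤ f r := fun r hr => by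
    have h0 : 0 ≤ r := ht.trans (le_of_lt hr)
    have := regGamma_nonneg k h0
    positivity
  have hd : ∀ r ∈ Ici t, HasDerivAt (fun r => regGamma (k + 1) r ^ (n + 1) / (n + 1)) (f r) r := by
    intro r _
    refine (((hasDerivAt_regGamma k r).pow (n + 1)).div_const (n + 1 : ℝ)).congr_deriv ?_
    have : (n + 1 : ℝ) ≠ 0 := by positivity
    rw [hf]
    push_cast
    field_simp
  have hl : Tendsto (fun r => regGamma (k + 1) r ^ (n + 1) / (n + 1)) atTop
      (𝓝 (1 ^ (n + 1) / ((n : ℝ) + 1))) :=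
    ((tendsto_regGamma_atTop k).pow (n + 1)).div_const _
  have hint := integrableOn_Ioi_deriv_of_nonneg' hd hnn hl
  have hval := integral_Ioi_of_hasDerivAt_of_nonneg' hd hnn hl
  rw [one_pow, ← sub_div] at hval
  rw [← hval, ofReal_integral_eq_lintegral_ofReal hint
    ((ae_restrict_mem measurableSet_Ioi).mono hnn), gammaLaw,
    restrict_withDensity measurableSet_Ioi, Measure.restrict_restrict measurableSet_Ioi,
    ← gammaLaw, inter_eq_left.2 (Ioi_subset_Ioi ht)]
  rw [lintegral_withDensity_eq_lintegral_mul _ (by fun_prop) (measurable_measure_Iio_pow _ _)]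
  refine setLIntegral_congr_fun measurableSet_Ioi fun r hr => ?_
  have h0 : 0 ≤ r := ht.trans (le_of_lt hr)
  have := regGamma_nonneg k h0
  simp only [Pi.mul_apply, hf]
  rw [gammaLaw_Iio k h0, ← ENNReal.ofReal_pow this, ← ENNReal.ofReal_mul (by positivity)]

/-- The probability that a given one of `n + 2` independent Gamma variables is the largest. -/
lemma lintegral_gammaLaw_Iio_pow (k n : ℕ) :
    ∫⁻ r, (∫⁻ _ in Iio r, 1 ∂gammaLaw k) * gammaLaw k (Iio r) ^ n ∂gammaLaw k =
      ENNReal.ofReal (1 / (n + 2)) := by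
  have h := setLIntegral_Ioi_gammaLaw_pow k (n + 1) le_rfl
  have h0 : regGamma (k + 1) 0 = 0 := by simp [regGamma]
  rw [h0, Measure.restrict_eq_self_of_ae_mem (s := Ioi 0) (ae_gammaLaw_pos k)] at h
  simp only [setLIntegral_one, ← pow_succ']
  rw [h]
  congr 1
  push_cast
  ring

/-- The density of `gammaLaw (m + 1)` divided by its variable. -/
lemma lintegral_gammaLaw_inv_mul (m : ℕ) {φ : ℝ → ℝ≥0∞} (hφ : Measurable φ) :
    ∫⁻ r, (ENNReal.ofReal r)⁻¹ * φ r ∂gammaLaw (m + 1) =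
      ∫⁻ r in Ioi 0, ENNReal.ofReal (Real.exp (-r) * r ^ m / (m + 1).factorial) * φ r := by
  rw [lintegral_gammaLaw _ (by fun_prop)]
  refine setLIntegral_congr_fun measurableSet_Ioi fun r hr => ?_
  have hr : 0 < r := hr
  rw [← ENNReal.ofReal_inv_of_pos hr, ← mul_assoc, ← ENNReal.ofReal_mul (by positivity)]
  congr 2
  field_simp
  ring

lemma integrableOn_exp_neg_mul_pow_div (m : ℕ) :
    IntegrableOn (fun r : ℝ => Real.exp (-r) * r ^ m / (m + 1).factorial) (Ioi 0) ∧
      ∫ r in Ioi (0 : ℝ), Real.exp (-r) * r ^ m / (m + 1).factorial = 1 / (m + 1) := by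
  have hnn : ∀ᵐ r ∂volume.restrict (Ioi (0 : ℝ)),
      0 ≤ Real.exp (-r) * r ^ m / (m + 1).factorial := by
    filter_upwards [ae_restrict_mem measurableSet_Ioi] with r hr
    have : (0 : ℝ) < r := hr
    positivity
  have hval : ∫⁻ r in Ioi (0 : ℝ), ENNReal.ofReal (Real.exp (-r) * r ^ m / (m + 1).factorial) =
      ENNReal.ofReal (1 / (m + 1)) := by
    have h1 : ∫⁻ r in Ioi (0 : ℝ), ENNReal.ofReal (Real.exp (-r) * r ^ m / m.factorial) = 1 := by
      have := lintegral_gammaLaw m (φ := fun _ => 1) measurable_const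
      simpa using this.symm
    rw [← mul_one (ENNReal.ofReal (1 / (m + 1))), ← h1, ← lintegral_const_mul _ (by fun_prop)]
    refine lintegral_congr fun r => ?_
    rw [← ENNReal.ofReal_mul (by positivity), Nat.factorial_succ]
    congr 1
    push_cast
    field_simp
  constructor
  · refine (lintegral_ofReal_ne_top_iff_integrable (by fun_prop) hnn).1 ?_
    rw [hval]
    exact ofReal_ne_top
  · rw [integral_eq_lintegral_of_nonneg_ae hnn (by fun_prop), hval,
      ENNReal.toReal_ofReal (by positivity)]

lemma regGamma_le_one (n : ℕ) {x : ℝ} (hx : 0 ≤ x) : regGamma (n + 1) x ≤ 1 := by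
  have := prob_le_one (μ := gammaLaw n) (s := Iio x)
  rwa [gammaLaw_Iio n hx, ENNReal.ofReal_le_one] at this

lemma integrableOn_alphaConst (m n : ℕ) :
    IntegrableOn (fun r : ℝ => Real.exp (-r) * r ^ m / (m + 1).factorial *
      regGamma (m + 2) r ^ (n + 1)) (Ioi 0) := by
  refine (integrableOn_exp_neg_mul_pow_div m).1.mono' ?_ ?_
  · have := (continuous_regGamma (m + 1)).measurable
    fun_prop
  · filter_upwards [ae_restrict_mem measurableSet_Ioi] with r hr
    have hr : (0 : ℝ) < r := hr
    have h0 := regGamma_nonneg (m + 1) hr.le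
    have h1 := regGamma_le_one (m + 1) hr.le
    rw [Real.norm_of_nonneg (by positivity)]
    exact mul_le_of_le_one_right (by positivity) (pow_le_one₀ h0 h1)

lemma integral_eq_alphaConst_div (m n : ℕ) :
    ∫ r in Ioi (0 : ℝ), Real.exp (-r) * r ^ m / (m + 1).factorial *
      regGamma (m + 2) r ^ (n + 1) = alphaConst (m + 2) (n + 2) / (n + 2) := by
  unfold alphaConst
  rw [← integral_div]
  refine setIntegral_congr_fun measurableSet_Ioi fun r _ => ?_
  have hG : Real.Gamma (m + 2 : ℕ) = (m + 1).factorial := by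
    rw [← Real.Gamma_nat_eq_factorial]; push_cast; ring_nf
  rw [hG, show m + 2 - 2 = m by lia, show n + 2 - 1 = n + 1 by lia]
  push_cast
  field_simp

/-- The mean inverse of the largest of `n + 2` Gamma variables, restricted to the event that the
largest is a given one. -/
lemma lintegral_inv_gammaLaw_Iio_pow (m n : ℕ) :
    ∫⁻ r, (∫⁻ _ in Iio r, (ENNReal.ofReal r)⁻¹ ∂gammaLaw (m + 1)) *
      gammaLaw (m + 1) (Iio r) ^ n ∂gammaLaw (m + 1) =
      ENNReal.ofReal (alphaConst (m + 2) (n + 2) / (n + 2)) := by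
  simp only [setLIntegral_const, mul_assoc, ← pow_succ']
  rw [lintegral_gammaLaw_inv_mul m (measurable_measure_Iio_pow _ _), ← integral_eq_alphaConst_div,
    ofReal_integral_eq_lintegral_ofReal (integrableOn_alphaConst m n)]
  · refine setLIntegral_congr_fun measurableSet_Ioi fun r hr => ?_
    have hr : (0 : ℝ) < r := hr
    rw [gammaLaw_Iio _ hr.le, ← ENNReal.ofReal_pow (regGamma_nonneg _ hr.le),
      ← ENNReal.ofReal_mul (by positivity)]
  · filter_upwards [ae_restrict_mem measurableSet_Ioi] with r hr
    have hr : (0 : ℝ) < r := hr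
    have h0 := regGamma_nonneg (m + 1) hr.le
    positivity

/-- The mean inverse of a given one of `n + 2` Gamma variables, restricted to the event that
another given one is the largest. -/
lemma lintegral_setLIntegral_inv_gammaLaw (m n : ℕ) :
    ∫⁻ r, (∫⁻ t in Iio r, (ENNReal.ofReal t)⁻¹ ∂gammaLaw (m + 1)) *
      gammaLaw (m + 1) (Iio r) ^ n ∂gammaLaw (m + 1) =
      ENNReal.ofReal ((1 / (m + 1) - alphaConst (m + 2) (n + 2) / (n + 2)) / (n + 1)) := by
  set γ := gammaLaw (m + 1)
  have hG := measurable_measure_Iio_pow γ n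
  have hset : MeasurableSet {p : ℝ × ℝ | p.2 < p.1} :=
    measurableSet_lt measurable_snd measurable_fst
  have h1 : ∀ r, (∫⁻ t in Iio r, (ENNReal.ofReal t)⁻¹ ∂γ) * γ (Iio r) ^ n =
      ∫⁻ t, {p : ℝ × ℝ | p.2 < p.1}.indicator
        (fun p => (ENNReal.ofReal p.2)⁻¹ * γ (Iio p.1) ^ n) (r, t) ∂γ := by
    intro r
    rw [← lintegral_mul_const _ (by fun_prop), ← lintegral_indicator measurableSet_Iio]
    rfl
  have h2 : ∀ t, ∫⁻ r, {p : ℝ × ℝ | p.2 < p.1}.indicator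
        (fun p => (ENNReal.ofReal p.2)⁻¹ * γ (Iio p.1) ^ n) (r, t) ∂γ =
      (ENNReal.ofReal t)⁻¹ * ∫⁻ r in Ioi t, γ (Iio r) ^ n ∂γ := by
    intro t
    rw [← lintegral_const_mul _ hG, ← lintegral_indicator measurableSet_Ioi]
    rfl
  have hmeas : Measurable ({p : ℝ × ℝ | p.2 < p.1}.indicator
      (fun p => (ENNReal.ofReal p.2)⁻¹ * γ (Iio p.1) ^ n)) :=
    ((by fun_prop : Measurable fun p : ℝ × ℝ => (ENNReal.ofReal p.2)⁻¹).mul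
      (hG.comp measurable_fst)).indicator hset
  simp only [h1]
  rw [lintegral_lintegral_swap (f := fun r t => {p : ℝ × ℝ | p.2 < p.1}.indicator
    (fun p => (ENNReal.ofReal p.2)⁻¹ * γ (Iio p.1) ^ n) (r, t)) hmeas.aemeasurable]
  simp only [h2]
  have h3 : ∫⁻ t, (ENNReal.ofReal t)⁻¹ * ∫⁻ r in Ioi t, γ (Iio r) ^ n ∂γ ∂γ =
      ∫⁻ t, (ENNReal.ofReal t)⁻¹ *
        ENNReal.ofReal ((1 - regGamma (m + 2) t ^ (n + 1)) / (n + 1)) ∂γ := by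
    refine lintegral_congr_ae ?_
    filter_upwards [ae_gammaLaw_pos (m + 1)] with t ht
    rw [setLIntegral_Ioi_gammaLaw_pow _ _ ht.le]
  have hR := (continuous_regGamma (m + 1)).measurable
  rw [h3, lintegral_gammaLaw_inv_mul m (by fun_prop), ← integral_eq_alphaConst_div,
    ← (integrableOn_exp_neg_mul_pow_div m).2,
    ← integral_sub (integrableOn_exp_neg_mul_pow_div m).1 (integrableOn_alphaConst m n),
    ← integral_div]
  refine Eq.trans ?_ (ofReal_integral_eq_lintegral_ofReal
    (((integrableOn_exp_neg_mul_pow_div m).1.sub (integrableOn_alphaConst m n)).div_const _)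
    ?_).symm
  · refine setLIntegral_congr_fun measurableSet_Ioi fun r hr => ?_
    have hr : (0 : ℝ) < r := hr
    rw [← ENNReal.ofReal_mul (by positivity)]
    congr 1
    simp only [Pi.sub_apply]
    ring
  · filter_upwards [ae_restrict_mem measurableSet_Ioi] with r hr
    have hr : (0 : ℝ) < r := hr
    have h0 := regGamma_nonneg (m + 1) hr.le
    have h1 := regGamma_le_one (m + 1) hr.le
    have h2 : regGamma (m + 2) r ^ (n + 1) ≤ 1 := pow_le_one₀ h0 h1
    refine div_nonneg (sub_nonneg.2 (mul_le_of_le_one_right (by positivity) h2)) (by positivity)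

end Constants

/-! ### Moments of the selected users -/

section SelectedUsers

open Set ENNReal

variable {m n : ℕ}

lemma isAngleBasedSelection_of_mem_selectionEvent {i : Fin (n + 2)} {l : Fin (n + 1)}
    {x : Fin (n + 2) → EuclideanSpace ℂ (Fin (m + 2))} (hx : x ∈ selectionEvent m n i l) :
    IsAngleBasedSelection x i (i.succAbove l) where
  strongest := (Fin.forall_iff_succAbove i).2
    ⟨le_rfl, fun k => (lt_of_pow_lt_pow_left₀ 2 (norm_nonneg _) (hx.1 k)).le⟩
  ne := Fin.succAbove_ne i l
  most_orthogonal := (Fin.forall_iff_succAbove i).2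
    ⟨fun h => (h rfl).elim, (Fin.forall_iff_succAbove l).2
      ⟨fun _ => le_rfl, fun k _ => (hx.2 k).le⟩⟩

lemma IsAngleBasedSelection.eq_of_mem_selectionEvent {i a b : Fin (n + 2)} {l : Fin (n + 1)}
    {x : Fin (n + 2) → EuclideanSpace ℂ (Fin (m + 2))} (h : IsAngleBasedSelection x a b)
    (hx : x ∈ selectionEvent m n i l) : a = i ∧ b = i.succAbove l := by
  have ha : a = i := by
    by_contra hne
    obtain ⟨k, rfl⟩ := Fin.exists_succAbove_eq hne
    exact (lt_of_pow_lt_pow_left₀ 2 (norm_nonneg _) (hx.1 k)).not_ge (h.strongest i)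
  subst ha
  refine ⟨rfl, ?_⟩
  obtain ⟨k, rfl⟩ := Fin.exists_succAbove_eq h.ne
  by_contra hne
  obtain ⟨k', rfl⟩ := Fin.exists_succAbove_eq (fun hkl => hne (congrArg a.succAbove hkl))
  exact (hx.2 k').not_ge (h.most_orthogonal _ (Fin.succAbove_ne a l))

lemma measure_selectionEvent (i : Fin (n + 2)) (l : Fin (n + 1)) :
    Measure.pi (fun _ => channelLaw (m + 2)) (selectionEvent m n i l) =
      ENNReal.ofReal (1 / (n + 2) * (1 / (n + 1))) := by
  have h := setLIntegral_selectionEvent (m := m) i l (ψ := fun _ => 1) measurable_const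
    (χ := fun _ => 1) measurable_const
  rw [lintegral_powLaw_pow_Iio, lintegral_gammaLaw_Iio_pow,
    ← ENNReal.ofReal_mul (by positivity)] at h
  rw [← h]
  simp

/-- The selection events exhaust the probability space: their probabilities add up to `1`. -/
lemma ae_exists_mem_selectionEvent (m n : ℕ) :
    ∀ᵐ x ∂Measure.pi (fun _ : Fin (n + 2) => channelLaw (m + 2)),
      ∃ p : Fin (n + 2) × Fin (n + 1), x ∈ selectionEvent m n p.1 p.2 := by
  have hdisj : Pairwise (Function.onFun Disjoint
      fun p : Fin (n + 2) × Fin (n + 1) => selectionEvent m n p.1 p.2) := by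
    intro p q hpq
    refine Set.disjoint_left.2 fun x hp hq => hpq ?_
    obtain ⟨h1, h2⟩ :=
      (isAngleBasedSelection_of_mem_selectionEvent hp).eq_of_mem_selectionEvent hq
    rw [h1] at h2
    exact Prod.ext h1 (Fin.succAbove_right_injective h2)
  have hm : Measure.pi (fun _ : Fin (n + 2) => channelLaw (m + 2))
      (⋃ p : Fin (n + 2) × Fin (n + 1), selectionEvent m n p.1 p.2) = 1 := by
    rw [measure_iUnion hdisj fun p => measurableSet_selectionEvent _ _, tsum_fintype]
    simp only [measure_selectionEvent, Finset.sum_const, Finset.card_univ, Fintype.card_prod,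
      Fintype.card_fin, nsmul_eq_mul]
    rw [← ENNReal.ofReal_natCast, ← ENNReal.ofReal_mul (by positivity), ← ENNReal.ofReal_one]
    congr 1
    push_cast
    field_simp
  have h := (prob_compl_eq_zero_iff
    (MeasurableSet.iUnion fun p => measurableSet_selectionEvent _ _)).2 hm
  filter_upwards [measure_eq_zero_iff_ae_notMem.1 h] with x hx
  simpa using hx

variable {Ω : Type*} [MeasurableSpace Ω] {P : Measure Ω}
  {h : Fin (n + 2) → Ω → EuclideanSpace ℂ (Fin (m + 2))} {first second : Ω → Fin (n + 2)}

/-- Almost surely, a function of the channels of the two selected users is given by the expression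
that belongs to the one selection event that occurs. -/
lemma ae_selected_eq_sum (hh : IsGaussianChannel P h)
    (hsel : ∀ᵐ ω ∂P, IsAngleBasedSelection (fun k => h k ω) (first ω) (second ω))
    {β : Type*} [AddCommMonoid β]
    (g : EuclideanSpace ℂ (Fin (m + 2)) → EuclideanSpace ℂ (Fin (m + 2)) → β) :
    (fun ω => g (h (second ω) ω) (h (first ω) ω)) =ᵐ[P] fun ω =>
      ∑ p : Fin (n + 2) × Fin (n + 1), (selectionEvent m n p.1 p.2).indicator
        (fun x => g (x (p.1.succAbove p.2)) (x p.1)) (fun k => h k ω) := by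
  have hae := ae_exists_mem_selectionEvent m n
  rw [← hh.hasLaw.map_eq] at hae
  filter_upwards [hsel, ae_of_ae_map hh.hasLaw.aemeasurable hae] with ω hω hex
  obtain ⟨p, hp⟩ := hex
  obtain ⟨h1, h2⟩ := hω.eq_of_mem_selectionEvent hp
  rw [Finset.sum_eq_single p _ (by simp), indicator_of_mem hp, h1, h2]
  intro q _ hq
  refine indicator_of_notMem (fun hmem => hq ?_) _
  obtain ⟨h3, h4⟩ := hω.eq_of_mem_selectionEvent hmem
  rw [h1] at h3
  rw [h2, h3] at h4
  exact Prod.ext h3.symm (Fin.succAbove_right_injective h4).symm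

lemma measurable_sum_indicator_selectionEvent {β : Type*} [AddCommMonoid β] [MeasurableSpace β]
    [MeasurableAdd₂ β] {g : EuclideanSpace ℂ (Fin (m + 2)) → EuclideanSpace ℂ (Fin (m + 2)) → β}
    (hg : ∀ i j : Fin (n + 2), Measurable fun x : Fin (n + 2) → EuclideanSpace ℂ (Fin (m + 2)) =>
      g (x i) (x j)) :
    Measurable fun x => ∑ p : Fin (n + 2) × Fin (n + 1),
      (selectionEvent m n p.1 p.2).indicator (fun x => g (x (p.1.succAbove p.2)) (x p.1)) x :=
  Finset.measurable_sum _ fun _ _ => (hg _ _).indicator (measurableSet_selectionEvent _ _)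

lemma aemeasurable_selected (hh : IsGaussianChannel P h)
    (hsel : ∀ᵐ ω ∂P, IsAngleBasedSelection (fun k => h k ω) (first ω) (second ω))
    {β : Type*} [AddCommMonoid β] [MeasurableSpace β] [MeasurableAdd₂ β]
    {g : EuclideanSpace ℂ (Fin (m + 2)) → EuclideanSpace ℂ (Fin (m + 2)) → β}
    (hg : ∀ i j : Fin (n + 2), Measurable fun x : Fin (n + 2) → EuclideanSpace ℂ (Fin (m + 2)) =>
      g (x i) (x j)) :
    AEMeasurable (fun ω => g (h (second ω) ω) (h (first ω) ω)) P :=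
  ((measurable_sum_indicator_selectionEvent hg).comp_aemeasurable hh.hasLaw.aemeasurable).congr
    (ae_selected_eq_sum hh hsel g).symm

lemma lintegral_selected (hh : IsGaussianChannel P h)
    (hsel : ∀ᵐ ω ∂P, IsAngleBasedSelection (fun k => h k ω) (first ω) (second ω))
    {g : EuclideanSpace ℂ (Fin (m + 2)) → EuclideanSpace ℂ (Fin (m + 2)) → ℝ≥0∞}
    (hg : ∀ i j : Fin (n + 2), Measurable fun x : Fin (n + 2) → EuclideanSpace ℂ (Fin (m + 2)) =>
      g (x i) (x j)) :
    ∫⁻ ω, g (h (second ω) ω) (h (first ω) ω) ∂P =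
      ∑ p : Fin (n + 2) × Fin (n + 1), ∫⁻ x in selectionEvent m n p.1 p.2,
        g (x (p.1.succAbove p.2)) (x p.1) ∂Measure.pi (fun _ => channelLaw (m + 2)) := by
  rw [lintegral_congr_ae (ae_selected_eq_sum hh hsel g)]
  rw [hh.hasLaw.lintegral_comp (f := fun x => ∑ p : Fin (n + 2) × Fin (n + 1),
      (selectionEvent m n p.1 p.2).indicator (fun x => g (x (p.1.succAbove p.2)) (x p.1)) x)
      (measurable_sum_indicator_selectionEvent hg).aemeasurable,
    lintegral_finsetSum _ fun p _ => (hg _ _).indicator (measurableSet_selectionEvent _ _)]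
  exact Finset.sum_congr rfl fun p _ => lintegral_indicator (measurableSet_selectionEvent _ _) _

/-- The mean of `1 / (‖f‖² sin² θ)`, with values in `[0, ∞]`. -/
lemma lintegral_selected_inv_mul_inv (hMK : 1 < (m + 1) * (n + 1)) (hh : IsGaussianChannel P h)
    (hsel : ∀ᵐ ω ∂P, IsAngleBasedSelection (fun k => h k ω) (first ω) (second ω)) :
    ∫⁻ ω, (ENNReal.ofReal (‖h (first ω) ω‖ ^ 2))⁻¹ * (ENNReal.ofReal
        (sinSqAngle (h (second ω) ω) (Submodule.span ℂ {h (first ω) ω})))⁻¹ ∂P =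
      ENNReal.ofReal ((m + 1) * (n + 1) * alphaConst (m + 2) (n + 2) /
        ((m + 1) * (n + 1) - 1)) := by
  have hS := fun i j : Fin (n + 2) => measurable_sinSqAngle_apply (M := m + 2) i j
  rw [lintegral_selected hh hsel (g := fun s f => (ENNReal.ofReal (‖f‖ ^ 2))⁻¹ *
    (ENNReal.ofReal (sinSqAngle s (Submodule.span ℂ {f})))⁻¹)
    (fun i j => by have := hS i j; fun_prop)]
  have key := fun (i : Fin (n + 2)) (l : Fin (n + 1)) =>
    setLIntegral_selectionEvent (m := m) i l (ψ := fun p => (ENNReal.ofReal p.1)⁻¹) (by fun_prop)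
      (χ := fun s => (ENNReal.ofReal s)⁻¹) (by fun_prop)
  simp only [key, lintegral_powLaw_inv_mul_pow_Iio m n hMK, lintegral_inv_gammaLaw_Iio_pow,
    Finset.sum_const, Finset.card_univ, Fintype.card_prod, Fintype.card_fin, nsmul_eq_mul]
  have hpos : (0 : ℝ) < (m + 1) * (n + 1) - 1 := by
    have : (1 : ℝ) < (m + 1) * (n + 1) := by exact_mod_cast hMK
    linarith
  rw [mul_comm (ENNReal.ofReal _), ← ENNReal.ofReal_natCast, ← ENNReal.ofReal_mul (by positivity),
    ← ENNReal.ofReal_mul (by positivity)]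
  congr 1
  push_cast
  field_simp

/-- The mean of `1 / ‖s‖²`, with values in `[0, ∞]`. -/
lemma lintegral_selected_inv (hh : IsGaussianChannel P h)
    (hsel : ∀ᵐ ω ∂P, IsAngleBasedSelection (fun k => h k ω) (first ω) (second ω)) :
    ∫⁻ ω, (ENNReal.ofReal (‖h (second ω) ω‖ ^ 2))⁻¹ ∂P =
      ENNReal.ofReal (1 / (n + 1) * ((n + 2) / (m + 1) - alphaConst (m + 2) (n + 2))) := by
  rw [lintegral_selected hh hsel (g := fun s f => (ENNReal.ofReal (‖s‖ ^ 2))⁻¹)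
    (fun i j => by fun_prop)]
  have key := fun (i : Fin (n + 2)) (l : Fin (n + 1)) =>
    setLIntegral_selectionEvent (m := m) i l (ψ := fun p => (ENNReal.ofReal p.2)⁻¹) (by fun_prop)
      (χ := fun _ => 1) (by fun_prop)
  simp only [mul_one] at key
  simp only [key, lintegral_powLaw_pow_Iio, lintegral_setLIntegral_inv_gammaLaw,
    Finset.sum_const, Finset.card_univ, Fintype.card_prod, Fintype.card_fin, nsmul_eq_mul]
  rw [mul_comm (ENNReal.ofReal _), ← ENNReal.ofReal_natCast, ← ENNReal.ofReal_mul (by positivity),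
    ← ENNReal.ofReal_mul (by positivity)]
  congr 1
  push_cast
  field_simp

lemma alphaConst_nonneg (m n : ℕ) : 0 ≤ alphaConst (m + 2) (n + 2) := by
  refine setIntegral_nonneg measurableSet_Ioi fun r hr => ?_
  have hr : (0 : ℝ) < r := hr
  have h0 := regGamma_nonneg (m + 1) hr.le
  have : 0 < Real.Gamma (m + 2 : ℕ) := Real.Gamma_pos_of_pos (by positivity)
  positivity

lemma alphaConst_le (m n : ℕ) : alphaConst (m + 2) (n + 2) ≤ (n + 2) / (m + 1) := by
  have h : alphaConst (m + 2) (n + 2) / (n + 2) ≤ 1 / (m + 1) := by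
    rw [← integral_eq_alphaConst_div, ← (integrableOn_exp_neg_mul_pow_div m).2]
    refine setIntegral_mono_on (integrableOn_alphaConst m n)
      (integrableOn_exp_neg_mul_pow_div m).1 measurableSet_Ioi fun r hr => ?_
    have hr : (0 : ℝ) < r := hr
    have h0 := regGamma_nonneg (m + 1) hr.le
    have h1 := regGamma_le_one (m + 1) hr.le
    exact mul_le_of_le_one_right (by positivity) (pow_le_one₀ h0 h1)
  rw [div_le_div_iff₀ (by positivity) (by positivity)] at h
  rw [le_div_iff₀ (by positivity)]
  linarith

lemma integrable_integral_eq_of_lintegral_ofReal_eq {f : Ω → ℝ} {c : ℝ} (hc : 0 ≤ c)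
    (hf : AEMeasurable f P) (hf0 : 0 ≤ᵐ[P] f)
    (h : ∫⁻ ω, ENNReal.ofReal (f ω) ∂P = ENNReal.ofReal c) :
    Integrable f P ∧ ∫ ω, f ω ∂P = c := by
  constructor
  · refine (lintegral_ofReal_ne_top_iff_integrable hf.aestronglyMeasurable hf0).1 ?_
    rw [h]
    exact ofReal_ne_top
  · rw [integral_eq_lintegral_of_nonneg_ae hf0 hf.aestronglyMeasurable, h,
      ENNReal.toReal_ofReal hc]

/-- Almost surely the channel of the second user does not vanish, nor is it parallel to the channel
of the first: this is read off from the finiteness of the inverse moments. -/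
lemma ae_selected_ne_zero (hMK : 1 < (m + 1) * (n + 1)) (hh : IsGaussianChannel P h)
    (hsel : ∀ᵐ ω ∂P, IsAngleBasedSelection (fun k => h k ω) (first ω) (second ω)) :
    ∀ᵐ ω ∂P, h (second ω) ω ≠ 0 ∧ h (first ω) ω ≠ 0 ∧
      0 < sinSqAngle (h (second ω) ω) (Submodule.span ℂ {h (first ω) ω}) := by
  have hS := fun i j : Fin (n + 2) => measurable_sinSqAngle_apply (M := m + 2) i j
  have h1 := ae_lt_top' (aemeasurable_selected hh hsel
    (g := fun s f => (ENNReal.ofReal (‖f‖ ^ 2))⁻¹ *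
      (ENNReal.ofReal (sinSqAngle s (Submodule.span ℂ {f})))⁻¹)
    (fun i j => by have := hS i j; fun_prop))
    ((lintegral_selected_inv_mul_inv hMK hh hsel).trans_ne ofReal_ne_top)
  have h2 := ae_lt_top' (aemeasurable_selected hh hsel
    (g := fun s f => (ENNReal.ofReal (‖s‖ ^ 2))⁻¹) (fun i j => by fun_prop))
    ((lintegral_selected_inv hh hsel).trans_ne ofReal_ne_top)
  filter_upwards [h1, h2, hsel] with ω hω1 hω2 hω
  have hs : h (second ω) ω ≠ 0 := by
    intro h0
    simp [h0] at hω2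
  have hf : h (first ω) ω ≠ 0 :=
    norm_pos_iff.1 ((norm_pos_iff.2 hs).trans_le (hω.strongest (second ω)))
  refine ⟨hs, hf, ?_⟩
  by_contra hneg
  rw [ENNReal.ofReal_of_nonpos (not_lt.1 hneg), ENNReal.inv_zero, ENNReal.mul_top (by simp)] at hω1
  exact lt_irrefl _ hω1

lemma integral_selected_one_div (hMK : 1 < (m + 1) * (n + 1)) (hh : IsGaussianChannel P h)
    (hsel : ∀ᵐ ω ∂P, IsAngleBasedSelection (fun k => h k ω) (first ω) (second ω)) :
    Integrable (fun ω => 1 / ‖h (second ω) ω‖ ^ 2) P ∧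
      ∫ ω, 1 / ‖h (second ω) ω‖ ^ 2 ∂P =
        1 / (n + 1) * ((n + 2) / (m + 1) - alphaConst (m + 2) (n + 2)) := by
  refine integrable_integral_eq_of_lintegral_ofReal_eq
    (mul_nonneg (by positivity) (sub_nonneg.2 (alphaConst_le m n)))
    (aemeasurable_selected hh hsel (g := fun s f => 1 / ‖s‖ ^ 2) (fun i j => by fun_prop))
    (ae_of_all _ fun ω => by simp) ?_
  rw [← lintegral_selected_inv hh hsel]
  refine lintegral_congr_ae ?_
  filter_upwards [ae_selected_ne_zero hMK hh hsel] with ω hω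
  have := norm_pos_iff.2 hω.1
  rw [one_div, ENNReal.ofReal_inv_of_pos (by positivity)]

lemma integral_selected_one_div_mul (hMK : 1 < (m + 1) * (n + 1)) (hh : IsGaussianChannel P h)
    (hsel : ∀ᵐ ω ∂P, IsAngleBasedSelection (fun k => h k ω) (first ω) (second ω)) :
    Integrable (fun ω => 1 / (‖h (first ω) ω‖ ^ 2 *
        sinSqAngle (h (first ω) ω) (Submodule.span ℂ {h (second ω) ω}))) P ∧
      ∫ ω, 1 / (‖h (first ω) ω‖ ^ 2 *
        sinSqAngle (h (first ω) ω) (Submodule.span ℂ {h (second ω) ω})) ∂P =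
        (m + 1) * (n + 1) * alphaConst (m + 2) (n + 2) / ((m + 1) * (n + 1) - 1) := by
  have hS := fun i j : Fin (n + 2) => measurable_sinSqAngle_apply (M := m + 2) i j
  have hpos : (0 : ℝ) < (m + 1) * (n + 1) - 1 := by
    have : (1 : ℝ) < (m + 1) * (n + 1) := by exact_mod_cast hMK
    linarith
  have hα := alphaConst_nonneg m n
  refine integrable_integral_eq_of_lintegral_ofReal_eq (by positivity)
    (aemeasurable_selected hh hsel
      (g := fun s f => 1 / (‖f‖ ^ 2 * sinSqAngle f (Submodule.span ℂ {s})))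
      (fun i j => by have := hS j i; fun_prop))
    (ae_of_all _ fun ω => ?_) ?_
  · have := sinSqAngle_span_singleton_nonneg (h (first ω) ω) (h (second ω) ω)
    simp only [Pi.zero_apply]
    positivity
  rw [← lintegral_selected_inv_mul_inv hMK hh hsel]
  refine lintegral_congr_ae ?_
  filter_upwards [ae_selected_ne_zero hMK hh hsel] with ω hω
  have h1 := norm_pos_iff.2 hω.2.1
  have h2 := hω.2.2
  rw [sinSqAngle_span_singleton_comm, one_div, mul_inv, ENNReal.ofReal_mul (by positivity),
    ENNReal.ofReal_inv_of_pos (by positivity), ENNReal.ofReal_inv_of_pos h2]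

end SelectedUsers

/-! ### Average transmit power -/

section AveragePower

open Set ENNReal Filter Topology

/-- The exact power is at most its high-SINR expression. -/
lemma one_add_div_le_one_div {γ A S : ℝ} (hγ : 0 < γ) (hA : 0 < A) (hS0 : 0 < S) (hS1 : S ≤ 1) :
    (1 + γ) / (A * (1 + γ * S)) ≤ 1 / (A * S) := by
  rw [div_le_div_iff₀ (by positivity) (by positivity)]
  nlinarith [mul_nonneg hA.le (sub_nonneg.2 hS1)]

lemma tendsto_one_add_div {A S : ℝ} (hS : 0 < S) :
    Tendsto (fun γ : ℝ => (1 + γ) / (A * (1 + γ * S))) atTop (𝓝 (1 / (A * S))) := by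
  have h : Tendsto (fun γ : ℝ => (γ⁻¹ + 1) / (A * (γ⁻¹ + S))) atTop
      (𝓝 ((0 + 1) / (A * (0 + S)))) := by
    rcases eq_or_ne A 0 with rfl | hA
    · simp
    · exact (tendsto_inv_atTop_zero.add_const 1).div
        ((tendsto_inv_atTop_zero.add_const S).const_mul A) (by positivity)
  rw [zero_add, zero_add] at h
  refine h.congr' ?_
  filter_upwards [eventually_gt_atTop 0] with γ hγ
  have h1 : γ⁻¹ + 1 = γ⁻¹ * (1 + γ) := by field_simp
  have h2 : A * (γ⁻¹ + S) = γ⁻¹ * (A * (1 + γ * S)) := by field_simp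
  rw [h1, h2, mul_div_mul_left _ _ (inv_ne_zero hγ.ne')]

end AveragePower

theorem mainTheorem5 {Ω : Type*} [MeasurableSpace Ω] (P : Measure Ω) [IsProbabilityMeasure P]
    (M K : ℕ) (hM : 2 ≤ M) (hK : 2 ≤ K) (hMK : 1 < (M - 1) * (K - 1))
    (h : Fin K → Ω → EuclideanSpace ℂ (Fin M)) (hh : IsGaussianChannel P h)
    (first second : Ω → Fin K)
    (hsel : ∀ᵐ ω ∂P, IsAngleBasedSelection (fun k => h k ω) (first ω) (second ω))
    (σ : ℝ) (hσ : 0 < σ) :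
    (∀ γ : ℝ, 0 < γ →
      Integrable (fun ω => highSINRPower σ γ ![h (second ω) ω, h (first ω) ω]) P ∧
      ∫ ω, highSINRPower σ γ ![h (second ω) ω, h (first ω) ω] ∂P =
        γ * σ ^ 2 *
          (1 / ((K : ℝ) - 1) * ((K : ℝ) / ((M : ℝ) - 1) - alphaConst M K) +
            ((M : ℝ) - 1) * ((K : ℝ) - 1) * alphaConst M K /
              (((M : ℝ) - 1) * ((K : ℝ) - 1) - 1))) ∧
    (∀ γ : ℝ, 0 < γ →
      (∀ᵐ ω ∂P, IsLeast (achievablePowers σ γ ![h (second ω) ω, h (first ω) ω])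
        (minTransmitPower σ γ ![h (second ω) ω, h (first ω) ω])) ∧
      Integrable (fun ω => minTransmitPower σ γ ![h (second ω) ω, h (first ω) ω]) P) ∧
    Asymptotics.IsEquivalent Filter.atTop
      (fun γ : ℝ => ∫ ω, minTransmitPower σ γ ![h (second ω) ω, h (first ω) ω] ∂P)
      (fun γ : ℝ => γ * σ ^ 2 *
          (1 / ((K : ℝ) - 1) * ((K : ℝ) / ((M : ℝ) - 1) - alphaConst M K) +
            ((M : ℝ) - 1) * ((K : ℝ) - 1) * alphaConst M K /
              (((M : ℝ) - 1) * ((K : ℝ) - 1) - 1))) := by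
  obtain ⟨m, rfl⟩ : ∃ m, M = m + 2 := ⟨M - 2, by lia⟩
  obtain ⟨n, rfl⟩ : ∃ n, K = n + 2 := ⟨K - 2, by lia⟩
  have hMK' : 1 < (m + 1) * (n + 1) := hMK
  have hM1 : ((m + 2 : ℕ) : ℝ) - 1 = m + 1 := by push_cast; ring
  have hK1 : ((n + 2 : ℕ) : ℝ) - 1 = n + 1 := by push_cast; ring
  have hK2 : ((n + 2 : ℕ) : ℝ) = n + 2 := by push_cast; ring
  rw [hM1, hK1, hK2]
  obtain ⟨hu, hu'⟩ := integral_selected_one_div hMK' hh hsel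
  obtain ⟨hw, hw'⟩ := integral_selected_one_div_mul hMK' hh hsel
  have hne := ae_selected_ne_zero hMK' hh hsel
  set C : ℝ := 1 / (n + 1) * ((n + 2) / (m + 1) - alphaConst (m + 2) (n + 2)) +
    (m + 1) * (n + 1) * alphaConst (m + 2) (n + 2) / ((m + 1) * (n + 1) - 1) with hC
  have huwi : Integrable (fun ω => 1 / ‖h (second ω) ω‖ ^ 2 + 1 / (‖h (first ω) ω‖ ^ 2 *
      sinSqAngle (h (first ω) ω) (Submodule.span ℂ {h (second ω) ω}))) P := hu.add hw
  have huw : ∫ ω, (1 / ‖h (second ω) ω‖ ^ 2 + 1 / (‖h (first ω) ω‖ ^ 2 *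
      sinSqAngle (h (first ω) ω) (Submodule.span ℂ {h (second ω) ω}))) ∂P = C := by
    rw [integral_add hu hw, hu', hw']
  have hleast : ∀ γ : ℝ, 0 < γ → ∀ᵐ ω ∂P,
      IsLeast (achievablePowers σ γ ![h (second ω) ω, h (first ω) ω])
        (orderedPower σ γ (h (first ω) ω) (h (second ω) ω)) := by
    intro γ hγ
    filter_upwards [hne, hsel] with ω hω hωs
    exact isLeast_achievablePowers hσ hγ hω.1 hω.2.1 (hωs.strongest _)
  have hmin : ∀ γ : ℝ, 0 < γ →
      (fun ω => minTransmitPower σ γ ![h (second ω) ω, h (first ω) ω]) =ᵐ[P]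
        fun ω => orderedPower σ γ (h (first ω) ω) (h (second ω) ω) := by
    intro γ hγ
    filter_upwards [hleast γ hγ] with ω hω
    exact hω.csInf_eq
  -- the minimum power divided by `γ * σ ^ 2`
  set F : ℝ → Ω → ℝ := fun γ ω => 1 / ‖h (second ω) ω‖ ^ 2 + (1 + γ) / (‖h (first ω) ω‖ ^ 2 *
      (1 + γ * sinSqAngle (h (first ω) ω) (Submodule.span ℂ {h (second ω) ω}))) with hF
  have hFmeas : ∀ γ, AEStronglyMeasurable (F γ) P := by
    intro γ
    have hS := fun i j : Fin (n + 2) => measurable_sinSqAngle_apply (M := m + 2) i j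
    exact (aemeasurable_selected hh hsel (g := fun s f => 1 / ‖s‖ ^ 2 + (1 + γ) / (‖f‖ ^ 2 *
      (1 + γ * sinSqAngle f (Submodule.span ℂ {s}))))
      (fun i j => by have := hS j i; fun_prop)).aestronglyMeasurable
  have hFbound : ∀ γ : ℝ, 0 < γ → ∀ᵐ ω ∂P, ‖F γ ω‖ ≤ 1 / ‖h (second ω) ω‖ ^ 2 +
      1 / (‖h (first ω) ω‖ ^ 2 *
        sinSqAngle (h (first ω) ω) (Submodule.span ℂ {h (second ω) ω})) := by
    intro γ hγ
    filter_upwards [hne] with ω hω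
    have h1 := norm_pos_iff.2 hω.2.1
    have h2 := hω.2.2
    rw [sinSqAngle_span_singleton_comm] at h2
    rw [hF, Real.norm_of_nonneg (by positivity)]
    refine add_le_add le_rfl ?_
    exact one_add_div_le_one_div hγ (by positivity) h2 (sinSqAngle_le_one _ _)
  have hFint : ∀ γ : ℝ, 0 < γ → Integrable (F γ) P := fun γ hγ =>
    huwi.mono' (hFmeas γ) (hFbound γ hγ)
  refine ⟨fun γ hγ => ?_, fun γ hγ => ⟨?_, ?_⟩, ?_⟩
  · simp only [highSINRPower_pair]
    refine ⟨huwi.const_mul _, ?_⟩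
    rw [integral_const_mul, huw]
  · filter_upwards [hleast γ hγ, hmin γ hγ] with ω h1 h2
    rwa [h2]
  · exact ((hFint γ hγ).const_mul (γ * σ ^ 2)).congr (hmin γ hγ).symm
  · have hlim : Filter.Tendsto (fun γ => ∫ ω, F γ ω ∂P) Filter.atTop (nhds C) := by
      rw [← huw]
      refine tendsto_integral_filter_of_dominated_convergence _
        (Filter.Eventually.of_forall hFmeas) ?_ huwi ?_
      · filter_upwards [Filter.eventually_gt_atTop 0] with γ hγ using hFbound γ hγ
      · filter_upwards [hne] with ω hω
        have h2 := hω.2.2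
        rw [sinSqAngle_span_singleton_comm] at h2
        exact (tendsto_one_add_div h2).const_add _
    -- `C` is the integral of an almost surely positive function
    have hC0 : C ≠ 0 := by
      intro h0
      rw [h0, integral_eq_zero_iff_of_nonneg_ae _ huwi] at huw
      · obtain ⟨ω, hω, hω'⟩ := (hne.and huw).exists
        have h1 := norm_pos_iff.2 hω.1
        have h2 := sinSqAngle_span_singleton_nonneg (h (first ω) ω) (h (second ω) ω)
        have : 0 < 1 / ‖h (second ω) ω‖ ^ 2 + 1 / (‖h (first ω) ω‖ ^ 2 *
          sinSqAngle (h (first ω) ω) (Submodule.span ℂ {h (second ω) ω})) := by positivity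
        exact this.ne' hω'
      · refine ae_of_all _ fun ω => ?_
        have h2 := sinSqAngle_span_singleton_nonneg (h (first ω) ω) (h (second ω) ω)
        simp only [Pi.zero_apply]
        positivity
    have hmul : Asymptotics.IsEquivalent Filter.atTop
        (fun γ : ℝ => γ * σ ^ 2 * ∫ ω, F γ ω ∂P) (fun γ : ℝ => γ * σ ^ 2 * C) :=
      Asymptotics.IsEquivalent.refl.mul
        ((Asymptotics.isEquivalent_const_iff_tendsto hC0).2 hlim)
    refine hmul.congr_left ?_
    filter_upwards [Filter.eventually_gt_atTop 0] with γ hγ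
    rw [integral_congr_ae (hmin γ hγ), ← integral_const_mul]
    rfl
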